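/- Let $\mathcal{H}$ be a real Hilbert space, identified with its dual by the Riesz isomorphism, and let $\mathcal{V}$ be a real reflexive Banach space, continuously and densely embedded into $\mathcal{H}$, so that $\mathcal{V}\subseteq\mathcal{H}\equiv\mathcal{H}^*\subseteq\mathcal{V}^*$, where $h\in\mathcal{H}$ acts on $\mathcal{V}$ by $v\mapsto\langle h,v\rangle_{\mathcal{H}}$. Let $\Lambda$, with domain $D(\Lambda,\mathcal{H})$, be the generator of a $C_0$-contraction semigroup of linear operators on $\mathcal{H}$ whose restrictions to $\mathcal{V}$ form a $C_0$-semigroup of bounded linear operators on $\mathcal{V}$. Let $\mathcal{A}:\mathcal{V}\to\mathcal{V}^*$ be a (possibly nonlinear) operator such that 1. either $\mathcal{A}$ is monotone, i.e. ${}_{\mathcal{V}^*}\langle \mathcal{A}v_1-\mathcal{A}v_2,v_1-v_2\rangle_{\mathcal{V}}\ge 0$ for all $v_1,v_2\in\mathcal{V}$, and hemicontinuous, i.e. $s\mapsto {}_{\mathcal{V}^*}\langle\mathcal{A}(v_1+sv_2),v\rangle_{\mathcal{V}}$ is continuous on $\mathbb{R}$ for all $v_1,v_2,v\in\mathcal{V}$;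 or $\mathcal{A}$ is pseudo-monotone, i.e. whenever $v_n\rightharpoonup v$ weakly in $\mathcal{V}$ and $\limsup_{n\to\infty}{}_{\mathcal{V}^*}\langle\mathcal{A}v_n,v_n-v\rangle_{\mathcal{V}}\le 0$, then ${}_{\mathcal{V}^*}\langle\mathcal{A}v,v-u\rangle_{\mathcal{V}}\le\liminf_{n\to\infty}{}_{\mathcal{V}^*}\langle\mathcal{A}v_n,v_n-u\rangle_{\mathcal{V}}$ for all $u\in\mathcal{V}$; 2. $\mathcal{A}$ is coercive, i.e. ${}_{\mathcal{V}^*}\langle\mathcal{A}v,v\rangle_{\mathcal{V}}/\|v\|_{\mathcal{V}}\to\infty$ as $\|v\|_{\mathcal{V}}\to\infty$; 3. $\mathcal{A}$ maps bounded subsets of $\mathcal{V}$ to bounded subsets of $\mathcal{V}^*$. Then $\Lambda: D(\Lambda,\mathcal{H})\cap\mathcal{V}\to\mathcal{V}^*$ is closable as an operator from $\mathcal{V}$ to $\mathcal{V}^*$, and, denoting its closure by $(\Lambda,\mathcal{F})$, for every $f\in\mathcal{V}^*$ there exists $u\in\mathcal{F}$ with $$\mathcal{A}u-\Lambda u=f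 .$$ -/

import Mathlib

open Filter Topology Set
open scoped NNReal

/-- A real Banach space is reflexive if the canonical embedding into its bidual is onto. -/
def IsReflexiveBanach (X : Type*) [NormedAddCommGroup X] [NormedSpace ℝ X] : Prop :=
  Function.Surjective (NormedSpace.inclusionInDoubleDual ℝ X)

/-- `C₀`-semigroups (strongly continuous one-parameter semigroups) of bounded linear operators. -/
structure IsC0Semigroup {X : Type*} [NormedAddCommGroup X] [NormedSpace ℝ X]
    (T : ℝ≥0 → X →L[ℝ] X) : Prop where
  map_zero : T 0 = ContinuousLinearMap.id ℝ X
  map_add : ∀ s t : ℝ≥0, T (s + t) = (T s).comp (T t)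
  tendsto_zero : ∀ x : X, Tendsto (fun t : ℝ≥0 => T t x) (𝓝 0) (𝓝 x)

/-- `C₀`-contraction semigroups. -/
structure IsC0ContractionSemigroup {X : Type*} [NormedAddCommGroup X] [NormedSpace ℝ X]
    (T : ℝ≥0 → X →L[ℝ] X) : Prop extends IsC0Semigroup T where
  norm_le_one : ∀ t : ℝ≥0, ‖T t‖ ≤ 1

/-- The partially defined operator `Λ` is the (infinitesimal) generator of `T`: `x` lies in the
domain of `Λ` with `Λ x = y` if and only if `(T t x - x) / t → y` as `t ↓ 0`. -/
def IsSemigroupGenerator {X : Type*} [NormedAddCommGroup X] [NormedSpace ℝ X]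
    (T : ℝ≥0 → X →L[ℝ] X) (Λ : X →ₗ.[ℝ] X) : Prop :=
  ∀ x y : X, (x, y) ∈ Λ.graph ↔
    Tendsto (fun t : ℝ≥0 => (t : ℝ)⁻¹ • (T t x - x)) (𝓝[>] 0) (𝓝 y)

section Operators

variable {V : Type*} [NormedAddCommGroup V] [NormedSpace ℝ V]

/-- Monotonicity of `A : V → V*`. -/
def IsMonotoneOperator (A : V → StrongDual ℝ V) : Prop :=
  ∀ v₁ v₂ : V, 0 ≤ (A v₁ - A v₂) (v₁ - v₂)

/-- Hemicontinuity of `A : V → V*`. -/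
def IsHemicontinuousOperator (A : V → StrongDual ℝ V) : Prop :=
  ∀ v₁ v₂ v : V, Continuous fun s : ℝ => A (v₁ + s • v₂) v

/-- Pseudo-monotonicity of `A : V → V*`, in the sense of Brézis. The upper and lower limits are
taken in the extended reals. -/
def IsPseudoMonotoneOperator (A : V → StrongDual ℝ V) : Prop :=
  ∀ (v : ℕ → V) (v₀ : V),
    (∀ φ : StrongDual ℝ V, Tendsto (fun n => φ (v n)) atTop (𝓝 (φ v₀))) →
    limsup (fun n => ((A (v n) (v n - v₀) : ℝ) : EReal)) atTop ≤ 0 →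
    ∀ u : V, ((A v₀ (v₀ - u) : ℝ) : EReal) ≤
      liminf (fun n => ((A (v n) (v n - u) : ℝ) : EReal)) atTop

/-- Coercivity of `A : V → V*`: `⟨A v, v⟩ / ‖v‖ → ∞` as `‖v‖ → ∞`. -/
def IsCoerciveOperator (A : V → StrongDual ℝ V) : Prop :=
  Tendsto (fun v : V => A v v / ‖v‖) (Bornology.cobounded V) atTop

/-- `A : V → V*` maps bounded sets to bounded sets. -/
def IsBoundedOnBoundedSets (A : V → StrongDual ℝ V) : Prop :=
  ∀ s : Set V, Bornology.IsBounded s → Bornology.IsBounded (A '' s)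

variable {H : Type*} [NormedAddCommGroup H] [InnerProductSpace ℝ H]

/-- The embedding `H ≡ H* → V*` induced by the embedding `ι : V → H`, that is
`h ↦ (v ↦ ⟪h, ι v⟫)`. -/
noncomputable def gelfandEmbedding (ι : V →L[ℝ] H) : H →ₗ[ℝ] StrongDual ℝ V where
  toFun h := (innerSL ℝ h).comp ι
  map_add' x y := by ext v; simp
  map_smul' c x := by ext v; simp

/-- An operator `Λ` on `H`, regarded as an operator from `V` to `V*` with domain `D(Λ) ∩ V`. -/
noncomputable def gelfandOperator (ι : V →L[ℝ] H) (Λ : H →ₗ.[ℝ] H) :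
    V →ₗ.[ℝ] StrongDual ℝ V where
  domain := Λ.domain.comap ι.toLinearMap
  toFun := (gelfandEmbedding ι).comp
    (Λ.toFun.comp (ι.toLinearMap.restrict (p := Λ.domain.comap ι.toLinearMap) fun _ hv => hv))

end Operators

/-! ### Perturbations of the identity on a ball, and determinants -/

section Brouwer

open MeasureTheory Metric

variable {E : Type*} [NormedAddCommGroup E] [InnerProductSpace ℝ E]

/-! The unbounded `Λ` is replaced by the bounded difference quotients `Lₜ = (T t - 1)/t`, read as
maps from `V` to `V*`. Contractivity makes `-Lₜ` monotone, so `A - Lₜ` is still pseudo-monotone,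
bounded and coercive, and Brézis' theorem (`IsEventuallyPseudoMonotone.exists_eq`) solves `A uₜ - Lₜ
uₜ = f`. Coercivity bounds `uₜ` uniformly in `t`, hence also `Lₜ uₜ = A uₜ - f`.

The limit `t → 0` rests on `Lₜ = Λ Jₜ`, where `Jₜ` averages the orbit of the restricted semigroup
over `[0, t]`. The pairs `(Jₜ uₜ, Lₜ uₜ)` lie in the graph of `Λ`, whose closure is weakly closed.
Since the adjoint semigroup on `H` is strongly continuous, `Jₜ uₜ` and `uₜ` have the same weak limit
`u`, so `(u, g)` is in the closed graph. Dissipativity gives `limsup ⟨Lₜ uₜ, uₜ⟩ ≤ ⟨g, u⟩`, which is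
the upper limit condition for `A`; pseudo-monotonicity then yields `A u - g = f`
(`exists_mem_closure_of_approximation` and `exists_sub_eq_of_approximation`). Closability also
follows from dissipativity and density.

Brézis' theorem is proved by Galerkin approximation. The finite-dimensional problems are solved by a
Brouwer-type zero theorem, obtained from a volume argument against `C¹` retractions. As `V` need not
be separable while pseudo-monotonicity concerns sequences, `exists_seq_of_mem_weak_closure` extracts
sequences from the Galerkin net. -/

theorem exists_norm_eq_mem_segment {x y : E} {ρ : ℝ} (hx : ‖x‖ ≤ ρ) (hy : ρ ≤ ‖y‖) :
    ∃ z, ‖z‖ = ρ ∧ ‖x - z‖ ≤ ‖x - y‖ := by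
  have hc : ContinuousOn (fun s : ℝ => ‖x + s • (y - x)‖) (Icc 0 1) := by fun_prop
  obtain ⟨s, hs, h0⟩ := intermediate_value_Icc zero_le_one hc
    (show ρ ∈ _ from ⟨by simpa, by simpa⟩)
  refine ⟨_, h0, ?_⟩
  rw [sub_add_cancel_left, norm_neg, norm_smul, Real.norm_of_nonneg hs.1, norm_sub_rev x y]
  exact mul_le_of_le_one_left (norm_nonneg _) hs.2

/-- A Lipschitz map on a ball vanishing on the sphere extends by zero to a Lipschitz map. -/
theorem LipschitzOnWith.indicator_closedBall {h : E → E} {K : ℝ≥0} {ρ : ℝ}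
    (hh : LipschitzOnWith K h (closedBall 0 ρ)) (h0 : ∀ x, ‖x‖ = ρ → h x = 0) :
    LipschitzWith K ((closedBall 0 ρ).indicator h) := by
  -- A segment leaving the ball crosses the sphere, where `h` vanishes; the crossing point is no
  -- farther from `x` than `y` is.
  have key : ∀ x y : E, ‖x‖ ≤ ρ → ρ < ‖y‖ → ‖h x‖ ≤ K * ‖x - y‖ := by
    intro x y hx hy
    obtain ⟨z, hz, hxz⟩ := exists_norm_eq_mem_segment hx hy.le
    have := hh.norm_sub_le (x := x) (y := z) (by simpa using hx) (by simp [hz])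
    rw [h0 z hz, sub_zero] at this
    exact this.trans (by gcongr)
  refine LipschitzWith.of_dist_le_mul fun x y => ?_
  rw [dist_eq_norm, dist_eq_norm]
  by_cases hx : ‖x‖ ≤ ρ <;> by_cases hy : ‖y‖ ≤ ρ
  · rw [indicator_of_mem (by simpa), indicator_of_mem (by simpa)]
    exact hh.norm_sub_le (by simpa) (by simpa)
  · rw [indicator_of_mem (by simpa), indicator_of_notMem (by simpa using hy), sub_zero]
    exact key x y hx (not_le.1 hy)
  · rw [indicator_of_notMem (by simpa using hx), indicator_of_mem (by simpa), zero_sub, norm_neg,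
      norm_sub_rev]
    exact key y x hy (not_le.1 hx)
  · rw [indicator_of_notMem (by simpa using hx), indicator_of_notMem (by simpa using hy), sub_self,
      norm_zero]
    positivity

variable [FiniteDimensional ℝ E]

/-- The determinant of `1 + t M` is a polynomial in `t`, of degree at most the dimension. -/
theorem exists_polynomial_eval_eq_det_one_add_smul (M : E →L[ℝ] E) :
    ∃ p : Polynomial ℝ, p.natDegree ≤ Module.finrank ℝ E ∧
      ∀ t : ℝ, p.eval t = (1 + t • M : E →L[ℝ] E).det := by
  classical
  let b := Module.finBasis ℝ E
  let A := LinearMap.toMatrix b b (M : E →ₗ[ℝ] E)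
  refine ⟨Matrix.det ((Polynomial.X : Polynomial ℝ) • A.map Polynomial.C +
    (1 : Matrix _ _ ℝ).map Polynomial.C), ?_, fun t => ?_⟩
  · simpa using Polynomial.natDegree_det_X_add_C_le A 1
  · rw [← Polynomial.coe_evalRingHom, RingHom.map_det, ContinuousLinearMap.det,
      ← LinearMap.det_toMatrix b]
    congr 1
    have : LinearMap.toMatrix b b ((1 + t • M : E →L[ℝ] E) : E →ₗ[ℝ] E) = 1 + t • A := by
      rw [ContinuousLinearMap.toLinearMap_add, ContinuousLinearMap.toLinearMap_smul, map_add,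
        map_smul]
      congr 1
      exact LinearMap.toMatrix_one b
    rw [this]
    ext i j
    by_cases hij : i = j <;> simp [hij, add_comm (1 : ℝ), mul_comm t]

/-- Lagrange interpolation of `t ↦ det (1 + t M)`. -/
theorem det_one_add_eq_sum_lagrange (M : E →L[ℝ] E) (v : ℕ → ℝ) (hv : Function.Injective v) :
    (1 + M : E →L[ℝ] E).det = ∑ i ∈ Finset.range (Module.finrank ℝ E + 1),
      (Lagrange.basis (Finset.range (Module.finrank ℝ E + 1)) v i).eval 1 *
        (1 + v i • M : E →L[ℝ] E).det := by
  obtain ⟨p, hp, hpe⟩ := exists_polynomial_eval_eq_det_one_add_smul M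
  have hdeg : p.degree < (Finset.range (Module.finrank ℝ E + 1)).card := by
    rw [Finset.card_range]
    exact lt_of_le_of_lt Polynomial.degree_le_natDegree (by exact_mod_cast Nat.lt_succ_of_le hp)
  have := congrArg (Polynomial.eval 1) (Lagrange.eq_interpolate hv.injOn hdeg)
  rw [hpe, one_smul] at this
  rw [this, Lagrange.interpolate_apply, Polynomial.eval_finsetSum]
  exact Finset.sum_congr rfl fun i _ => by simp [hpe, mul_comm]

/-- Every `1 + s M` with `s ∈ [0, 1]` is injective, so the determinant cannot change sign on the
path from the identity. -/
theorem ContinuousLinearMap.det_one_add_pos_of_norm_le_half {M : E →L[ℝ] E} (hM : ‖M‖ ≤ 1 / 2) :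
    0 < (1 + M : E →L[ℝ] E).det := by
  have hne : ∀ s ∈ Icc (0 : ℝ) 1, (1 + s • M : E →L[ℝ] E).det ≠ 0 := by
    intro s hs h0
    obtain ⟨v, hv, hv0⟩ := (Submodule.ne_bot_iff _).1 (LinearMap.bot_lt_ker_of_det_eq_zero h0).ne'
    have h1 : v + s • M v = 0 := by simpa using hv
    have h2 : ‖s • M v‖ ≤ 1 / 2 * ‖v‖ := by
      rw [norm_smul, Real.norm_of_nonneg hs.1]
      calc s * ‖M v‖ ≤ 1 * (1 / 2 * ‖v‖) := by
            refine mul_le_mul hs.2 ((M.le_opNorm v).trans ?_) (norm_nonneg _) zero_le_one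
            gcongr
        _ = _ := one_mul _
    have h3 : ‖v‖ = ‖s • M v‖ := by
      conv_lhs => rw [eq_neg_of_add_eq_zero_left h1, norm_neg]
    have := norm_pos_iff.2 hv0
    linarith
  by_contra hneg
  have hc : ContinuousOn (fun s : ℝ => (1 + s • M : E →L[ℝ] E).det) (Icc 0 1) :=
    (ContinuousLinearMap.continuous_det.comp (by fun_prop)).continuousOn
  obtain ⟨s, hs, h0⟩ := intermediate_value_Icc' zero_le_one hc
    (show (0 : ℝ) ∈ _ from ⟨by simpa using not_lt.1 hneg, by simp [ContinuousLinearMap.det]⟩)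
  exact hne s hs h0

/-- A small Lipschitz perturbation of the identity supported in a ball permutes the ball. -/
theorem bijOn_ball_of_lipschitzOnWith {h : E → E} {K : ℝ≥0} {ρ : ℝ} (hK : K ≤ 1 / 2)
    (hh : LipschitzOnWith K h (closedBall 0 ρ)) (h0 : ∀ x, ‖x‖ = ρ → h x = 0) :
    BijOn (fun x => x + h x) (ball 0 ρ) (ball 0 ρ) := by
  set k := (closedBall (0 : E) ρ).indicator h with hk
  have hkL : LipschitzWith K k := hh.indicator_closedBall h0
  have hKr : (K : ℝ) ≤ 1 / 2 := by exact_mod_cast hK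
  have hkout : ∀ x, ρ ≤ ‖x‖ → k x = 0 := by
    intro x hx
    rcases hx.eq_or_lt with h | h
    · rw [hk, indicator_of_mem (by simp [← h]), h0 x h.symm]
    · rw [hk, indicator_of_notMem (by simpa using h)]
  have hinj : Function.Injective fun x => x + k x := by
    intro x y hxy
    have h1 : x - y = k y - k x := by
      have : x + k x = y + k y := hxy
      rw [sub_eq_sub_iff_add_eq_add, this, add_comm]
    have h2 := hkL.norm_sub_le y x
    rw [← h1, norm_sub_rev y x] at h2
    have h3 : ‖x - y‖ ≤ 0 := by nlinarith [norm_nonneg (x - y)]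
    exact sub_eq_zero.1 (norm_le_zero_iff.1 h3)
  have heq : EqOn (fun x => x + k x) (fun x => x + h x) (ball 0 ρ) := fun x hx => by
    simp only [hk]
    rw [indicator_of_mem (ball_subset_closedBall hx)]
  refine BijOn.congr ⟨fun x hx => ?_, hinj.injOn, fun y hy => ?_⟩ heq
  -- If the image of `x` lay outside the ball, the extended map would fix that image; injectivity
  -- would then identify it with `x`.
  · by_contra hout
    have h1 : ρ ≤ ‖x + k x‖ := by simpa using hout
    have h2 : x + k x = x := hinj (by simp only [hkout _ h1, add_zero])
    rw [h2] at h1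
    exact absurd (by simpa using hx) (not_lt.2 h1)
  -- A preimage of `y` is a fixed point of the contraction `x ↦ y - k x`.
  · have hcw : ContractingWith (1 / 2) fun x => y - k x := by
      refine ⟨by norm_num, LipschitzWith.of_dist_le_mul fun a b => ?_⟩
      rw [dist_sub_left]
      exact (hkL.dist_le_mul a b).trans (by gcongr)
    have : Nonempty E := ⟨0⟩
    have hfix : y - k (hcw.fixedPoint) = hcw.fixedPoint := hcw.fixedPoint_isFixedPt
    set x := hcw.fixedPoint
    have hxy : x + k x = y := (sub_eq_iff_eq_add.1 hfix).symm
    refine ⟨x, ?_, hxy⟩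
    by_contra hout
    have h1 : ρ ≤ ‖x‖ := by simpa using hout
    rw [hkout x h1, add_zero] at hxy
    rw [hxy] at h1
    exact absurd (by simpa using hy) (not_lt.2 h1)

end Brouwer

/-! ### Volume and the Jacobian integral -/

section NoRetraction

open MeasureTheory Metric

variable {E : Type*} [NormedAddCommGroup E] [InnerProductSpace ℝ E]

theorem continuous_det_one_add_smul_fderiv_sub {r : E → E} (hr : ContDiff ℝ 1 r) (t : ℝ) :
    Continuous fun x => (1 + t • (fderiv ℝ r x - 1) : E →L[ℝ] E).det := by
  have := hr.continuous_fderiv one_ne_zero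
  exact ContinuousLinearMap.continuous_det.comp (by fun_prop)

variable [FiniteDimensional ℝ E] [MeasurableSpace E] [BorelSpace E]

theorem integrableOn_ball_det {r : E → E} (hr : ContDiff ℝ 1 r) (t ρ : ℝ) :
    IntegrableOn (fun x => (1 + t • (fderiv ℝ r x - 1) : E →L[ℝ] E).det) (ball 0 ρ) :=
  ((continuous_det_one_add_smul_fderiv_sub hr t).continuousOn.integrableOn_compact
    (isCompact_closedBall 0 ρ)).mono_set ball_subset_closedBall

/-- If `r` fixes the sphere, then `x + t (r x - x)` preserves the volume of the ball for small
`t`. -/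
theorem integral_det_eq_volume_of_small {r : E → E} (hr : ContDiff ℝ 1 r) {ρ : ℝ}
    (hfix : ∀ x, ‖x‖ = ρ → r x = x) :
    ∃ τ > 0, ∀ t ∈ Icc (0 : ℝ) τ,
      ∫ x in ball (0 : E) ρ, (1 + t • (fderiv ℝ r x - 1) : E →L[ℝ] E).det =
        volume.real (ball (0 : E) ρ) := by
  obtain ⟨K, hK⟩ := (hr.sub contDiff_id).contDiffOn.exists_lipschitzOnWith one_ne_zero
    (convex_closedBall (0 : E) ρ) (isCompact_closedBall 0 ρ)
  -- The bound gives `t K ≤ 1/2`; the `+ 1` covers `K = 0`.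
  refine ⟨1 / (2 * (K + 1)), by positivity, fun t ht => ?_⟩
  have htK : t * K ≤ 1 / 2 := by
    have h1 := ht.2
    rw [le_div_iff₀ (by positivity)] at h1
    nlinarith [ht.1]
  have hL : LipschitzOnWith (t.toNNReal * K) (fun x => t • (r x - x)) (closedBall 0 ρ) := by
    refine LipschitzOnWith.of_dist_le_mul fun x hx y hy => ?_
    have := hK.dist_le_mul x hx y hy
    rw [dist_smul₀, Real.norm_of_nonneg ht.1]
    rw [NNReal.coe_mul, Real.coe_toNNReal t ht.1, mul_assoc]
    exact mul_le_mul_of_nonneg_left this ht.1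
  have htK' : t.toNNReal * K ≤ 1 / 2 := by
    rw [← NNReal.coe_le_coe, NNReal.coe_mul, Real.coe_toNNReal t ht.1]
    simpa using htK
  have hbij := bijOn_ball_of_lipschitzOnWith (K := t.toNNReal * K) htK' hL
    (fun x hx => by simp [hfix x hx])
  have hder : ∀ x, HasFDerivAt (fun x => x + t • (r x - x))
      (1 + t • (fderiv ℝ r x - 1) : E →L[ℝ] E) x := fun x =>
    (hasFDerivAt_id x).add
      ((((hr.differentiable one_ne_zero) x).hasFDerivAt.sub (hasFDerivAt_id x)).const_smul t)
  have hpos : ∀ x ∈ ball (0 : E) ρ, 0 < (1 + t • (fderiv ℝ r x - 1) : E →L[ℝ] E).det := by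
    intro x hx
    apply ContinuousLinearMap.det_one_add_pos_of_norm_le_half
    have h1 : HasFDerivAt (fun x => t • (r x - x)) (t • (fderiv ℝ r x - 1) : E →L[ℝ] E) x :=
      (((hr.differentiable one_ne_zero) x).hasFDerivAt.sub (hasFDerivAt_id x)).const_smul t
    exact (h1.le_of_lipschitzOn (mem_of_superset (isOpen_ball.mem_nhds hx)
      ball_subset_closedBall) hL).trans (by exact_mod_cast htK')
  have hvol := lintegral_abs_det_fderiv_eq_addHaar_image volume (measurableSet_ball (x := (0 : E))
    (ε := ρ)) (fun x _ => (hder x).hasFDerivWithinAt) hbij.injOn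
  rw [hbij.image_eq] at hvol
  rw [integral_eq_lintegral_of_nonneg_ae, Measure.real, ← hvol]
  · congr 1
    refine setLIntegral_congr_fun measurableSet_ball fun x hx => ?_
    rw [abs_of_pos (hpos x hx)]
  · exact (ae_restrict_iff' measurableSet_ball).2 (.of_forall fun x hx => (hpos x hx).le)
  · exact (continuous_det_one_add_smul_fderiv_sub hr t).aestronglyMeasurable

/-- If `r` fixes the sphere, the integral of its Jacobian over the ball is the volume of the
ball. -/
theorem integral_det_fderiv_eq_volume {r : E → E} (hr : ContDiff ℝ 1 r) {ρ : ℝ}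
    (hfix : ∀ x, ‖x‖ = ρ → r x = x) :
    ∫ x in ball (0 : E) ρ, (fderiv ℝ r x).det = volume.real (ball (0 : E) ρ) := by
  obtain ⟨τ, hτ, h⟩ := integral_det_eq_volume_of_small hr hfix
  set n := Module.finrank ℝ E + 1
  let v : ℕ → ℝ := fun i => τ / (i + 1)
  have hv : Function.Injective v := by
    intro i j hij
    have h1 : τ / ((i : ℝ) + 1) = τ / (j + 1) := hij
    rw [div_eq_div_iff (by positivity) (by positivity), mul_right_inj' hτ.ne'] at h1
    exact_mod_cast (add_right_cancel h1).symm
  have hvmem : ∀ i, v i ∈ Icc (0 : ℝ) τ := fun i =>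
    ⟨by positivity, div_le_self hτ.le (by linarith [(Nat.cast_nonneg i : (0 : ℝ) ≤ i)])⟩
  -- The Jacobian is the value at `t = 1` of a polynomial in `t`, interpolated from nodes in `[0,
  -- τ]`. At each node the integral is the volume, and the Lagrange weights sum to one.
  have hL : ∀ x, (fderiv ℝ r x).det = ∑ i ∈ Finset.range n,
      (Lagrange.basis (Finset.range n) v i).eval 1 *
        (1 + v i • (fderiv ℝ r x - 1) : E →L[ℝ] E).det := fun x => by
    rw [← det_one_add_eq_sum_lagrange _ v hv, add_sub_cancel]
  simp_rw [hL]
  rw [integral_finsetSum _ fun i _ => (integrableOn_ball_det hr _ ρ).const_mul _]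
  simp_rw [integral_const_mul, h _ (hvmem _)]
  rw [← Finset.sum_mul, ← Polynomial.eval_finsetSum, Lagrange.sum_basis hv.injOn ⟨0, by simp [n]⟩]
  simp

end NoRetraction

/-! ### Zeros of outward-pointing vector fields -/

section Zeros

open MeasureTheory Metric

variable {E : Type*} [NormedAddCommGroup E] [InnerProductSpace ℝ E] [FiniteDimensional ℝ E]

/-- There is no `C¹` retraction of a ball onto its boundary sphere. -/
theorem not_contDiff_retraction {r : E → E} (hr : ContDiff ℝ 1 r) {ρ : ℝ} (hρ : 0 < ρ)
    (hfix : ∀ x, ‖x‖ = ρ → r x = x) (hnorm : ∀ x, ‖r x‖ = ρ) : False := by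
  borelize E
  have h0 : ∀ x, (fderiv ℝ r x).det = 0 := by
    intro x
    by_contra hdet
    -- Since `‖r‖²` is constant, the range of the derivative is orthogonal to `r x ≠ 0`, so it
    -- cannot be onto.
    have hd := ((hr.differentiable one_ne_zero) x).hasFDerivAt
    have hsurj : Function.Surjective (fderiv ℝ r x) := 
      (LinearMap.equivOfDetNeZero (fderiv ℝ r x : E →ₗ[ℝ] E) hdet).surjective
    obtain ⟨w, hw⟩ := hsurj (r x)
    have h1 := hd.norm_sq
    have h2 : (fun y => ‖r y‖ ^ 2) = fun _ => ρ ^ 2 := by funext y; rw [hnorm]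
    rw [h2] at h1
    have h3 := congrArg (fun L => L w) (h1.unique (hasFDerivAt_const _ x))
    simp [hw, hnorm] at h3
    exact hρ.ne' h3
  have h1 := integral_det_fderiv_eq_volume hr hfix
  simp only [h0, integral_zero] at h1
  exact (ENNReal.toReal_pos (isOpen_ball.measure_pos volume ⟨0, by simpa⟩).ne'
    measure_ball_lt_top.ne).ne h1

/-- A continuous vector field on a finite-dimensional space which points outwards far away from
the origin has a zero. -/
theorem exists_eq_zero_of_inner_pos {F : E → E} (hF : Continuous F) {R : ℝ}
    (hpos : ∀ x, R ≤ ‖x‖ → 0 < inner ℝ (F x) x) : ∃ x, F x = 0 := by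
  by_contra! hne
  set ρ := max R 0 + 1
  have hρ : 0 < ρ := by positivity
  have hRρ : R < ρ := lt_of_le_of_lt (le_max_left R 0) (lt_add_one _)
  -- A `C¹` selection `G` of these convex sets never vanishes and is the identity outside the ball;
  -- rescaled to norm `ρ` it is a retraction. As `ρ > R`, the identity is an admissible local
  -- section near each point with `ρ ≤ ‖x‖`.
  let t : E → Set E := fun x => {z | 0 < inner ℝ (F x) z ∧ (ρ ≤ ‖x‖ → z = x)}
  have ht : ∀ x, Convex ℝ (t x) := by
    intro x
    refine Convex.inter (convex_halfSpace_gt (innerSL ℝ (F x)).toLinearMap.isLinear 0) ?_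
    change Convex ℝ {z : E | ρ ≤ ‖x‖ → z = x}
    by_cases h : ρ ≤ ‖x‖
    · simp [h, convex_singleton]
    · simp [h, convex_univ]
  obtain ⟨G, hG⟩ := exists_contMDiffMap_forall_mem_convex_of_local (n := 1)
    (modelWithCornersSelf ℝ E) ht
    (fun x => by
      by_cases h : ρ ≤ ‖x‖
      · refine ⟨{y | R < ‖y‖}, (isOpen_lt continuous_const continuous_norm).mem_nhds
          (hRρ.trans_le h), id, contMDiff_id.contMDiffOn, fun y hy => ⟨hpos y (le_of_lt hy), ?_⟩⟩
        simp
      · refine ⟨{y | 0 < inner ℝ (F y) (F x)} ∩ {y | ‖y‖ < ρ}, inter_mem ?_ ?_, fun _ => F x,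
          contMDiffOn_const, fun y hy => ⟨hy.1, fun h => absurd h (not_le.2 hy.2)⟩⟩
        · refine (isOpen_lt continuous_const (by fun_prop)).mem_nhds ?_
          exact real_inner_self_pos.2 (hne x)
        · exact (isOpen_lt continuous_norm continuous_const).mem_nhds (not_le.1 h))
  have hGs : ContDiff ℝ 1 G := G.contMDiff.contDiff
  have hG0 : ∀ x, G x ≠ 0 := fun x h => by
    have := (hG x).1
    rw [h, inner_zero_right] at this
    exact this.false
  refine not_contDiff_retraction (r := fun x => (ρ * ‖G x‖⁻¹) • G x) (ρ := ρ) ?_ hρ ?_ ?_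
  · exact (contDiff_const.mul ((hGs.norm ℝ hG0).inv fun x => norm_ne_zero_iff.2 (hG0 x))).smul hGs
  · intro x hx
    have : G x = x := (hG x).2 hx.ge
    simp only [this]
    rw [hx, mul_inv_cancel₀ hρ.ne', one_smul]
  · intro x
    rw [norm_smul, norm_mul, norm_inv, norm_norm, mul_assoc,
      inv_mul_cancel₀ (norm_ne_zero_iff.2 (hG0 x)), mul_one, Real.norm_of_nonneg hρ.le]

end Zeros

/-! ### Weak compactness and extraction of sequences -/

section WeakConvergence

variable {V : Type*} [NormedAddCommGroup V] [NormedSpace ℝ V]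

/-- Bounded families of functionals converge weak-* along ultrafilters. -/
theorem exists_tendsto_apply_of_ultrafilter {α : Type*} (𝒰 : Ultrafilter α)
    (f : α → StrongDual ℝ V) {R : ℝ} (hf : ∀ᶠ i in 𝒰, ‖f i‖ ≤ R) :
    ∃ g : StrongDual ℝ V, ∀ v, Tendsto (fun i => f i v) 𝒰 (𝓝 (g v)) := by
  obtain ⟨g, -, hg⟩ := (WeakDual.isCompact_closedBall (𝕜 := ℝ) (E := V) 0 R).ultrafilter_le_nhds
    (𝒰.map fun i => (f i).toWeakDual) (by
      rw [le_principal_iff]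
      exact hf.mono fun i hi => by simpa using hi)
  refine ⟨WeakDual.toStrongDual g, fun v => ?_⟩
  exact ((WeakDual.eval_continuous v).tendsto g).comp hg

/-- In a reflexive space, bounded families converge weakly along ultrafilters. -/
theorem IsReflexiveBanach.exists_weak_limit (h : IsReflexiveBanach V) {α : Type*}
    (𝒰 : Ultrafilter α) (x : α → V) {R : ℝ} (hx : ∀ᶠ i in 𝒰, ‖x i‖ ≤ R) :
    ∃ z : V, ∀ φ : StrongDual ℝ V, Tendsto (fun i => φ (x i)) 𝒰 (𝓝 (φ z)) := by
  obtain ⟨g, hg⟩ := exists_tendsto_apply_of_ultrafilter 𝒰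
    (fun i => NormedSpace.inclusionInDoubleDual ℝ V (x i)) (R := R) (by
      filter_upwards [hx] with i hi
      exact (NormedSpace.double_dual_bound ℝ V (x i)).trans hi)
  obtain ⟨z, rfl⟩ := h g
  exact ⟨z, fun φ => by simpa using hg φ⟩

/-- Hahn–Banach bounds a functional above on `Y`; by scaling, it must vanish there. -/
theorem Submodule.exists_dual_ne_zero_of_notMem (Y : Submodule ℝ V) (hY : IsClosed (Y : Set V))
    {z : V} (hz : z ∉ Y) : ∃ φ : StrongDual ℝ V, (∀ y ∈ Y, φ y = 0) ∧ φ z ≠ 0 := by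
  obtain ⟨φ, u, hu, huz⟩ := geometric_hahn_banach_closed_point Y.convex hY hz
  have h0 : 0 < u := by simpa using hu 0 Y.zero_mem
  refine ⟨φ, fun y hy => ?_, (h0.trans huz).ne'⟩
  by_contra hne
  have := hu ((u / φ y) • y) (Y.smul_mem _ hy)
  rw [map_smul, smul_eq_mul, div_mul_cancel₀ _ hne] at this
  exact this.false

/-- Closed subspaces are weakly closed. -/
theorem Submodule.mem_of_weak_limit (Y : Submodule ℝ V) (hY : IsClosed (Y : Set V))
    {α : Type*} {l : Filter α} [l.NeBot] {x : α → V} (hx : ∀ i, x i ∈ Y) {z : V}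
    (hz : ∀ φ : StrongDual ℝ V, Tendsto (fun i => φ (x i)) l (𝓝 (φ z))) : z ∈ Y := by
  by_contra hzY
  obtain ⟨φ, hφ, hne⟩ := Y.exists_dual_ne_zero_of_notMem hY hzY
  have h1 := hz φ
  simp only [hφ _ (hx _)] at h1
  exact hne (tendsto_nhds_unique h1 tendsto_const_nhds)

/-- A separable set admits a countable family of functionals separating the points of its closed
linear span. -/
theorem exists_separating_sequence {D : Set V} (hD : TopologicalSpace.IsSeparable D) :
    ∃ φ : ℕ → StrongDual ℝ V, (∀ k, ‖φ k‖ ≤ 1) ∧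
      ∀ z ∈ (Submodule.span ℝ D).topologicalClosure, (∀ k, φ k z = 0) → z = 0 := by
  obtain ⟨c, hc, hsub⟩ : TopologicalSpace.IsSeparable
      ((Submodule.span ℝ D).topologicalClosure : Set V) := by
    rw [Submodule.topologicalClosure_coe]
    exact (hD.span (R := ℝ)).closure
  have hne : c.Nonempty := by
    have : (0 : V) ∈ closure c := hsub (Submodule.zero_mem _)
    exact closure_nonempty_iff.1 ⟨0, this⟩
  obtain ⟨y, rfl⟩ := hc.exists_eq_range hne
  choose φ hφ hφy using fun k => exists_dual_vector'' ℝ (y k)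
  refine ⟨φ, hφ, fun z hz h0 => ?_⟩
  by_contra hz0
  have hpos := norm_pos_iff.2 hz0
  obtain ⟨_, ⟨k, rfl⟩, hk⟩ := Metric.mem_closure_iff.1 (hsub hz) (‖z‖ / 2) (by positivity)
  have h1 : ‖y k‖ ≤ ‖z - y k‖ := by
    have h2 : φ k (y k - z) = ‖y k‖ := by simp [h0, hφy]
    rw [← h2, norm_sub_rev]
    exact (le_abs_self _).trans (((φ k).le_of_opNorm_le (hφ k) _).trans (one_mul _).le)
  rw [dist_eq_norm] at hk
  have h3 : ‖z‖ ≤ ‖z - y k‖ + ‖y k‖ := norm_le_norm_sub_add _ _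
  linarith

/-- On bounded sequences in a subspace of a reflexive space, convergence against functionals
separating the points of the subspace is weak convergence. -/
theorem IsReflexiveBanach.tendsto_of_separating (h : IsReflexiveBanach V) {Y : Submodule ℝ V}
    (hY : IsClosed (Y : Set V)) {φ : ℕ → StrongDual ℝ V}
    (hφ : ∀ z ∈ Y, (∀ k, φ k z = 0) → z = 0) {x : ℕ → V} {R : ℝ} (hR : ∀ n, ‖x n‖ ≤ R)
    (hx : ∀ n, x n ∈ Y) {z : V} (hz : z ∈ Y)
    (hlim : ∀ k, Tendsto (fun n => φ k (x n)) atTop (𝓝 (φ k z))) (ψ : StrongDual ℝ V) :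
    Tendsto (fun n => ψ (x n)) atTop (𝓝 (ψ z)) := by
  -- Along each ultrafilter a weak limit exists, and the separating functionals force it to be `z`.
  refine tendsto_iff_ultrafilter _ _ _ |>.2 fun 𝒰 h𝒰 => ?_
  obtain ⟨w, hw⟩ := h.exists_weak_limit 𝒰 x (.of_forall hR)
  have hwY : w ∈ Y := Y.mem_of_weak_limit hY hx hw
  have : w - z = 0 := hφ _ (Y.sub_mem hwY hz) fun k => by
    rw [map_sub, sub_eq_zero]
    exact tendsto_nhds_unique (hw (φ k)) ((hlim k).mono_left h𝒰)
  rw [← sub_eq_zero.1 this]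
  exact hw ψ

/-- Bounded sequences in a reflexive space have weakly convergent subsequences. -/
theorem IsReflexiveBanach.exists_weak_subseq (h : IsReflexiveBanach V) {x : ℕ → V} {R : ℝ}
    (hR : ∀ n, ‖x n‖ ≤ R) :
    ∃ z : V, ∃ θ : ℕ → ℕ, StrictMono θ ∧
      ∀ ψ : StrongDual ℝ V, Tendsto (fun n => ψ (x (θ n))) atTop (𝓝 (ψ z)) := by
  obtain ⟨φ, -, hφ⟩ := exists_separating_sequence (countable_range x).isSeparable
  set Y := (Submodule.span ℝ (range x)).topologicalClosure
  have hYc : IsClosed (Y : Set V) := Submodule.isClosed_topologicalClosure _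
  have hxY : ∀ n, x n ∈ Y := fun n =>
    Submodule.le_topologicalClosure _ (Submodule.subset_span ⟨n, rfl⟩)
  -- Compactness of a countable product of intervals replaces the diagonal argument.
  obtain ⟨c, -, θ, hθ, hc⟩ := (isCompact_univ_pi fun k : ℕ =>
    isCompact_closedBall (0 : ℝ) (‖φ k‖ * R)).tendsto_subseq (x := fun n k => φ k (x n))
    fun n k _ => by
      rw [mem_closedBall_zero_iff]
      exact (φ k).le_opNorm_of_le (hR n)
  obtain ⟨z, hz⟩ := h.exists_weak_limit (hyperfilter ℕ) (x ∘ θ) (R := R)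
    (.of_forall fun n => hR _)
  have hzY : z ∈ Y := Y.mem_of_weak_limit hYc (fun n => hxY (θ n)) hz
  refine ⟨z, θ, hθ, fun ψ => h.tendsto_of_separating hYc hφ (fun n => hR (θ n))
    (fun n => hxY (θ n)) hzY (fun k => ?_) ψ⟩
  have h1 : Tendsto (fun n => φ k (x (θ n))) atTop (𝓝 (c k)) :=
    (continuous_apply k).continuousAt.tendsto.comp hc
  have h2 : φ k z = c k :=
    tendsto_nhds_unique (hz (φ k)) (h1.mono_left Nat.hyperfilter_le_atTop)
  rwa [h2]

/-- A point in the weak closure of a set can be approximated uniformly against `n`-tuples of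
functionals in the unit ball by points of a finite subset. -/
theorem exists_finset_of_mem_weak_closure {M : Set V} {z : V}
    (hz : ∀ (Φ : Finset (StrongDual ℝ V)) (ε : ℝ), 0 < ε → ∃ m ∈ M, ∀ φ ∈ Φ, |φ (m - z)| < ε)
    (n : ℕ) {ε : ℝ} (hε : 0 < ε) :
    ∃ S : Finset M, ∀ φ : Fin n → StrongDual ℝ V, (∀ i, ‖φ i‖ ≤ 1) →
      ∃ m ∈ S, ∀ i, |φ i ((m : V) - z)| < ε := by
  classical
  -- The `n`-fold power of the dual unit ball is weak-* compact, so finitely many points of `M`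
  -- serve all tuples.
  obtain ⟨S, hS⟩ := (isCompact_univ_pi fun _ : Fin n =>
    WeakDual.isCompact_closedBall (𝕜 := ℝ) (E := V) 0 1).elim_finite_subcover
      (fun m : M => {φ | ∀ i, |φ i ((m : V) - z)| < ε})
      (fun m => by
        simp only [ofPred_forall]
        exact isOpen_iInter_of_finite fun i => isOpen_lt
          ((WeakDual.eval_continuous _).comp (continuous_apply i)).abs continuous_const)
      (fun φ _ => by
        obtain ⟨m, hm, h⟩ := hz (Finset.univ.image fun i => WeakDual.toStrongDual (φ i)) ε hε
        exact mem_iUnion.2 ⟨⟨m, hm⟩, fun i => h _ (Finset.mem_image_of_mem _ (Finset.mem_univ i))⟩)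
  refine ⟨S, fun φ hφ => ?_⟩
  have hmem : (fun i => (φ i).toWeakDual) ∈ univ.pi fun _ : Fin n =>
      WeakDual.toStrongDual ⁻¹' Metric.closedBall (0 : StrongDual ℝ V) 1 :=
    fun i _ => by simpa using hφ i
  obtain ⟨m, hm, h⟩ := mem_iUnion₂.1 (hS hmem)
  exact ⟨m, hm, h⟩

/-- A point in the weak closure of a bounded subset of a reflexive space is the weak limit of a
sequence in the subset. -/
theorem IsReflexiveBanach.exists_seq_of_mem_weak_closure (h : IsReflexiveBanach V) {M : Set V}
    {R : ℝ} (hM : ∀ m ∈ M, ‖m‖ ≤ R) {z : V}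
    (hz : ∀ (Φ : Finset (StrongDual ℝ V)) (ε : ℝ), 0 < ε → ∃ m ∈ M, ∀ φ ∈ Φ, |φ (m - z)| < ε) :
    ∃ x : ℕ → V, (∀ n, x n ∈ M) ∧
      ∀ ψ : StrongDual ℝ V, Tendsto (fun n => ψ (x n)) atTop (𝓝 (ψ z)) := by
  choose S hS using fun n : ℕ =>
    exists_finset_of_mem_weak_closure hz n (Nat.one_div_pos_of_nat (α := ℝ) (n := n))
  -- All candidate points form a countable set, so countably many functionals separate its closed
  -- span. The `n`-th point chosen below is tested against the first `n` of them.
  let D : Set V := insert z (⋃ n, Subtype.val '' (S n : Set M))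
  have hD : D.Countable :=
    (countable_iUnion fun n => ((S n).finite_toSet.image _).countable).insert z
  obtain ⟨φ, hφ1, hφ⟩ := exists_separating_sequence hD.isSeparable
  set Y := (Submodule.span ℝ D).topologicalClosure
  have hDY : D ⊆ Y := Submodule.subset_span.trans (Submodule.le_topologicalClosure _)
  choose m hmS hm using fun n : ℕ => hS n (fun i => φ i) fun i => hφ1 i
  refine ⟨fun n => m n, fun n => (m n).2, h.tendsto_of_separating
    (Submodule.isClosed_topologicalClosure _) hφ (fun n => hM _ (m n).2)
    (fun n => hDY (mem_insert_of_mem _ (mem_iUnion.2 ⟨n, mem_image_of_mem _ (hmS n)⟩)))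
    (hDY (mem_insert z _)) fun k => ?_⟩
  rw [tendsto_iff_dist_tendsto_zero]
  refine squeeze_zero' (.of_forall fun _ => dist_nonneg) ?_ tendsto_one_div_add_atTop_nhds_zero_nat
  filter_upwards [eventually_gt_atTop k] with n hn
  rw [Real.dist_eq, ← map_sub]
  exact (hm n ⟨k, hn⟩).le

end WeakConvergence

/-! ### Pseudo-monotone operators -/

section PseudoMonotone

variable {V : Type*} [NormedAddCommGroup V] [NormedSpace ℝ V]

/-- Pseudo-monotonicity with the upper and lower limits spelled out by inequalities between real
numbers. -/
def IsEventuallyPseudoMonotone (A : V → StrongDual ℝ V) : Prop :=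
  ∀ (v : ℕ → V) (v₀ : V),
    (∀ φ : StrongDual ℝ V, Tendsto (fun n => φ (v n)) atTop (𝓝 (φ v₀))) →
    (∀ ε > 0, ∀ᶠ n in atTop, A (v n) (v n - v₀) ≤ ε) →
    ∀ u : V, ∀ ε > 0, ∀ᶠ n in atTop, A v₀ (v₀ - u) - ε ≤ A (v n) (v n - u)

theorem IsPseudoMonotoneOperator.isEventuallyPseudoMonotone {A : V → StrongDual ℝ V}
    (hA : IsPseudoMonotoneOperator A) : IsEventuallyPseudoMonotone A := by
  intro v v₀ hv hlim u ε hε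
  have h1 : limsup (fun n => ((A (v n) (v n - v₀) : ℝ) : EReal)) atTop ≤ 0 := by
    refine (limsup_le_iff (by isBoundedDefault) (by isBoundedDefault)).2 fun y hy => ?_
    obtain ⟨r, hr0, hry⟩ := EReal.lt_iff_exists_real_btwn.1 hy
    filter_upwards [hlim r (by exact_mod_cast hr0)] with n hn
    exact lt_of_le_of_lt (by exact_mod_cast hn) hry
  have h2 := (le_liminf_iff (by isBoundedDefault) (by isBoundedDefault)).1 (hA v v₀ hv h1 u)
    ((A v₀ (v₀ - u) - ε : ℝ) : EReal)
    (by exact_mod_cast sub_lt_self _ hε)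
  filter_upwards [h2] with n hn
  exact_mod_cast hn.le

/-- Minty's trick: test monotonicity at `w = v₀ + s (u - v₀)`, divide by `s`, and use hemicontinuity
to replace `A w` by `A v₀`. The error `s ε / 4` is fixed after `s`, so that it survives the
division. -/
theorem IsMonotoneOperator.isEventuallyPseudoMonotone {A : V → StrongDual ℝ V}
    (hA : IsMonotoneOperator A) (hc : IsHemicontinuousOperator A) :
    IsEventuallyPseudoMonotone A := by
  intro v v₀ hv hlim u ε hε
  have hsub : ∀ φ : StrongDual ℝ V, Tendsto (fun n => φ (v n - v₀)) atTop (𝓝 0) := fun φ => by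
    simpa using (hv φ).sub_const (φ v₀)
  have hlow : ∀ δ > 0, ∀ᶠ n in atTop, -δ ≤ A (v n) (v n - v₀) := fun δ hδ => by
    filter_upwards [(hsub (A v₀)).eventually (eventually_gt_nhds (neg_lt_zero.2 hδ))] with n hn
    have := hA (v n) v₀
    rw [sub_apply] at this
    linarith
  obtain ⟨s, hs, hs0⟩ : ∃ s : ℝ, A v₀ (v₀ - u) - ε / 4 < A (v₀ + s • (u - v₀)) (v₀ - u) ∧ 0 < s := by
    have h1 : Tendsto (fun s : ℝ => A (v₀ + s • (u - v₀)) (v₀ - u)) (𝓝[>] 0)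
        (𝓝 (A v₀ (v₀ - u))) := by
      have := (hc v₀ (u - v₀) (v₀ - u)).tendsto 0
      simp only [zero_smul, add_zero] at this
      exact this.mono_left nhdsWithin_le_nhds
    exact ((h1.eventually (eventually_gt_nhds (sub_lt_self _ (by positivity)))).and
      self_mem_nhdsWithin).exists
  set w := v₀ + s • (u - v₀) with hw
  have hδ : 0 < s * (ε / 4) := by positivity
  filter_upwards [hlim _ hδ, hlow (ε / 4) (by positivity),
    (hsub (A w)).eventually (eventually_gt_nhds (neg_lt_zero.2 hδ))] with n h1 h2 h3
  have h4 := hA (v n) w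
  have h5 : v n - w = (v n - v₀) + s • (v₀ - u) := by rw [hw]; module
  rw [sub_apply, h5, map_add, map_add, map_smul, map_smul, smul_eq_mul,
    smul_eq_mul] at h4
  have h6 : s * (A w (v₀ - u) - ε / 2) ≤ s * A (v n) (v₀ - u) := by linarith
  have h7 := le_of_mul_le_mul_left h6 hs0
  have h8 : A (v n) (v n - u) = A (v n) (v n - v₀) + A (v n) (v₀ - u) := by
    rw [← map_add]; congr 1; abel
  linarith

/-- Adding a bounded monotone linear operator preserves pseudo-monotonicity. -/
theorem IsEventuallyPseudoMonotone.add_linear {A : V → StrongDual ℝ V}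
    (hA : IsEventuallyPseudoMonotone A) (L : V →L[ℝ] StrongDual ℝ V) (hL : ∀ v, 0 ≤ L v v) :
    IsEventuallyPseudoMonotone fun v => A v + L v := by
  intro v v₀ hv hlim u ε hε
  have hsub : ∀ φ : StrongDual ℝ V, Tendsto (fun n => φ (v n - v₀)) atTop (𝓝 0) := fun φ => by
    simpa using (hv φ).sub_const (φ v₀)
  -- Monotonicity compares `L (v n)` with the fixed functional `L v₀`; this lower bound transfers
  -- the upper limit condition from the sum to `A`.
  have hlow : ∀ δ > 0, ∀ᶠ n in atTop, -δ < L (v n) (v n - v₀) := fun δ hδ => by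
    filter_upwards [(hsub (L v₀)).eventually (eventually_gt_nhds (neg_lt_zero.2 hδ))] with n hn
    have := hL (v n - v₀)
    rw [show L (v n - v₀) = L (v n) - L v₀ from map_sub L _ _, sub_apply] at this
    linarith
  have h1 := hA v v₀ hv (fun δ hδ => by
    filter_upwards [hlim (δ / 2) (by positivity), hlow (δ / 2) (by positivity)] with n h1 h2
    rw [add_apply] at h1
    linarith) u (ε / 3) (by positivity)
  have h2 : Tendsto (fun n => L (v n) (v₀ - u)) atTop (𝓝 (L v₀ (v₀ - u))) :=
    hv (L.flip (v₀ - u))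
  filter_upwards [h1, hlow (ε / 3) (by positivity),
    h2.eventually (eventually_gt_nhds (sub_lt_self _ (show 0 < ε / 3 by positivity)))]
    with n h3 h4 h5
  have h6 : L (v n) (v n - u) = L (v n) (v n - v₀) + L (v n) (v₀ - u) := by
    rw [← map_add]; congr 1; abel
  simp only [add_apply]
  linarith

theorem IsBoundedOnBoundedSets.exists_norm_le {A : V → StrongDual ℝ V}
    (hA : IsBoundedOnBoundedSets A) {s : Set V} (hs : Bornology.IsBounded s) :
    ∃ C, ∀ v ∈ s, ‖A v‖ ≤ C := by
  obtain ⟨C, hC⟩ := (hA s hs).exists_norm_le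
  exact ⟨C, fun v hv => hC _ (mem_image_of_mem A hv)⟩

theorem IsBoundedOnBoundedSets.add_linear {A : V → StrongDual ℝ V}
    (hA : IsBoundedOnBoundedSets A) (L : V →L[ℝ] StrongDual ℝ V) :
    IsBoundedOnBoundedSets fun v => A v + L v := by
  intro s hs
  obtain ⟨C, hC⟩ := hA.exists_norm_le hs
  obtain ⟨D, hD⟩ := hs.exists_norm_le
  refine isBounded_iff_forall_norm_le.2 ⟨C + ‖L‖ * D, ?_⟩
  rintro _ ⟨v, hv, rfl⟩
  exact (norm_add_le _ _).trans (add_le_add (hC v hv) (L.le_opNorm_of_le (hD v hv)))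

/-- Bounded pseudo-monotone operators are demicontinuous. -/
theorem IsEventuallyPseudoMonotone.demicontinuous {A : V → StrongDual ℝ V}
    (hA : IsEventuallyPseudoMonotone A) (hb : IsBoundedOnBoundedSets A) {x : ℕ → V} {z : V}
    (hx : Tendsto x atTop (𝓝 z)) (w : V) :
    Tendsto (fun n => A (x n) w) atTop (𝓝 (A z w)) := by
  obtain ⟨C, hC⟩ := hb.exists_norm_le (Metric.isBounded_range_of_tendsto x hx)
  have h0 : Tendsto (fun n => A (x n) (x n - z)) atTop (𝓝 0) := by
    refine squeeze_zero_norm (a := fun n => C * ‖x n - z‖) (fun n => ?_) ?_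
    · exact (A (x n)).le_of_opNorm_le (hC _ ⟨n, rfl⟩) _
    · simpa using (tendsto_iff_norm_sub_tendsto_zero.1 hx).const_mul C
  have key := hA x z (fun φ => (φ.continuous.tendsto z).comp hx) fun ε hε =>
    (h0.eventually (eventually_lt_nhds hε)).mono fun n hn => hn.le
  refine Metric.tendsto_atTop'.2 fun ε hε => ?_
  have hε3 : 0 < ε / 3 := by positivity
  -- The test points `z - w` and `z + w` give the lower and the upper bound.
  obtain ⟨N, hN⟩ := eventually_atTop.1 ((key (z - w) _ hε3).and ((key (z + w) _ hε3).and
    ((h0.eventually (eventually_lt_nhds hε3)).and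
      (h0.eventually (eventually_gt_nhds (neg_lt_zero.2 hε3))))))
  refine ⟨N, fun n hn => ?_⟩
  obtain ⟨h1, h2, h3, h4⟩ := hN n hn.le
  rw [sub_sub_cancel, show x n - (z - w) = (x n - z) + w by abel, map_add] at h1
  rw [sub_add_cancel_left, show x n - (z + w) = (x n - z) - w by abel, map_sub, map_neg] at h2
  rw [Real.dist_eq, abs_lt]
  constructor <;> linarith

end PseudoMonotone

/-! ### Galerkin approximation and Brézis' theorem -/

section Surjectivity

variable {V : Type*} [NormedAddCommGroup V] [NormedSpace ℝ V]

/-- Galerkin approximation: solvability of the equation tested against a finite-dimensional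
subspace. -/
theorem exists_galerkin_solution {B : V → StrongDual ℝ V}
    (hB : ∀ (x : ℕ → V) (z : V), Tendsto x atTop (𝓝 z) →
      ∀ w, Tendsto (fun n => B (x n) w) atTop (𝓝 (B z w)))
    {f : StrongDual ℝ V} {R : ℝ} (hpos : ∀ v, R ≤ ‖v‖ → f v < B v v)
    (W : Submodule ℝ V) [FiniteDimensional ℝ W] :
    ∃ u ∈ W, ∀ w ∈ W, B u w = f w := by
  let e := toEuclidean (E := W)
  let Φ := W.subtypeL.comp e.symm.toContinuousLinearMap
  let e' : W →L[ℝ] EuclideanSpace ℝ (Fin (Module.finrank ℝ W)) := e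
  let D := InnerProductSpace.toDual ℝ (EuclideanSpace ℝ (Fin (Module.finrank ℝ W)))
  let G := fun x => D.symm ((B (Φ x) - f).comp Φ)
  have hinner : ∀ x y, inner ℝ (G x) y = B (Φ x) (Φ y) - f (Φ y) := fun x y => by
    rw [InnerProductSpace.toDual_symm_apply]; rfl
  have hG : Continuous G := by
    refine D.symm.continuous.comp (continuous_clm_apply.2 fun y => ?_)
    refine continuous_iff_seqContinuous.2 fun x z hx => ?_
    exact (hB _ _ ((Φ.continuous.tendsto z).comp hx) (Φ y)).sub_const (f (Φ y))
  have hΦ : ∀ x, ‖x‖ ≤ ‖e'‖ * ‖Φ x‖ := fun x => by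
    simpa [Φ, e'] using e'.le_opNorm (e.symm x)
  -- This radius forces `‖Φ x‖ > |R|`.
  obtain ⟨x, hx⟩ := exists_eq_zero_of_inner_pos hG (R := ‖e'‖ * |R| + 1)
    fun x hx => by
      rw [hinner, sub_pos]
      refine hpos _ ?_
      by_contra! hlt
      have h1 : ‖Φ x‖ ≤ |R| := hlt.le.trans (le_abs_self R)
      have h2 : ‖e'‖ * ‖Φ x‖ ≤ ‖e'‖ * |R| := by gcongr
      have h3 := hΦ x
      linarith
  refine ⟨Φ x, (e.symm x).2, fun w hw => ?_⟩
  have h1 := hinner x (e ⟨w, hw⟩)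
  rw [hx, inner_zero_left] at h1
  have h2 : Φ (e ⟨w, hw⟩) = w := by simp [Φ]
  rw [h2] at h1
  exact sub_eq_zero.1 h1.symm

/-- Surjectivity of bounded coercive pseudo-monotone operators on reflexive spaces (Brézis). -/
theorem IsEventuallyPseudoMonotone.exists_eq (hrefl : IsReflexiveBanach V)
    {B : V → StrongDual ℝ V} (hB : IsEventuallyPseudoMonotone B) (hb : IsBoundedOnBoundedSets B)
    {f : StrongDual ℝ V} {R : ℝ} (hpos : ∀ v, R ≤ ‖v‖ → f v < B v v) : ∃ u, B u = f := by
  classical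
  choose u huW hu using fun s : Finset V => exists_galerkin_solution
    (fun x z hx w => hB.demicontinuous hb hx w) hpos (Submodule.span ℝ (s : Set V))
  have huR : ∀ s, ‖u s‖ ≤ R := fun s => by
    by_contra! hlt
    exact (hpos _ hlt.le).ne (hu s _ (huW s)).symm
  obtain ⟨z, hz⟩ := hrefl.exists_weak_limit (Ultrafilter.of (atTop : Filter (Finset V))) u
    (.of_forall huR)
  have hle : ∀ w, B z w ≤ f w := by
    intro w
    -- Only the Galerkin identities needed for this `w` are kept. They hold for all large subspaces,
    -- so `z` is in the weak closure of `M`, and on `M` they reduce `B m (m - z)` to `f (m - z)`.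
    let M := {m : V | ‖m‖ ≤ R ∧ B m z = f z ∧ B m (z - w) = f (z - w) ∧ B m m = f m}
    have hM : ∀ᶠ s in (Ultrafilter.of (atTop : Filter (Finset V)) : Filter (Finset V)),
        u s ∈ M := by
      refine Ultrafilter.of_le (atTop : Filter (Finset V)) ?_
      filter_upwards [eventually_ge_atTop ({z, w} : Finset V)] with s hs
      have h1 : z ∈ Submodule.span ℝ (s : Set V) :=
        Submodule.subset_span (hs (Finset.mem_insert_self _ _))
      have h2 : w ∈ Submodule.span ℝ (s : Set V) :=
        Submodule.subset_span (hs (Finset.mem_insert_of_mem (Finset.mem_singleton_self _)))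
      exact ⟨huR s, hu s _ h1, hu s _ (Submodule.sub_mem _ h1 h2), hu s _ (huW s)⟩
    obtain ⟨x, hxM, hx⟩ := hrefl.exists_seq_of_mem_weak_closure (M := M) (fun m hm => hm.1) (z := z)
      fun Ψ ε hε => by
        have h1 : ∀ᶠ s in (Ultrafilter.of (atTop : Filter (Finset V)) : Filter (Finset V)),
            ∀ φ ∈ Ψ, |φ (u s - z)| < ε := by
          refine (Finset.eventually_all Ψ).2 fun φ _ => ?_
          filter_upwards [Metric.tendsto_nhds.1 (hz φ) ε hε] with s hs
          rwa [map_sub, ← Real.dist_eq]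
        obtain ⟨s, hs⟩ := (hM.and h1).exists
        exact ⟨_, hs⟩
    have hfx := hx f
    have h3 := hB x z hx (fun ε hε => by
      filter_upwards [hfx.eventually (eventually_lt_nhds (lt_add_of_pos_right _ hε))] with n hn
      rw [map_sub, (hxM n).2.2.2, (hxM n).2.1]
      linarith) (z - w)
    refine le_of_forall_pos_le_add fun ε hε => ?_
    obtain ⟨n, h4, h5⟩ := ((h3 (ε / 2) (by positivity)).and (hfx.eventually (eventually_lt_nhds
      (lt_add_of_pos_right _ (show 0 < ε / 2 by positivity))))).exists
    rw [sub_sub_cancel, map_sub, (hxM n).2.2.2, (hxM n).2.2.1, map_sub] at h4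
    linarith
  refine ⟨z, ContinuousLinearMap.ext fun w => le_antisymm (hle w) ?_⟩
  simpa using hle (-w)

end Surjectivity

/-! ### Orbits and their averages -/

section Semigroup

variable {X : Type*} [NormedAddCommGroup X] [NormedSpace ℝ X]

/-- A `C₀`-semigroup is bounded for small times. -/
theorem IsC0Semigroup.exists_norm_le [CompleteSpace X] {T : ℝ≥0 → X →L[ℝ] X}
    (hT : IsC0Semigroup T) : ∃ δ > (0 : ℝ), ∃ M : ℝ, ∀ s : ℝ≥0, s ≤ δ → ‖T s‖ ≤ M := by
  by_contra! hcon
  choose s hs hns using fun n : ℕ => hcon (1 / ((n : ℝ) + 1)) (by positivity) n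
  have hs0 : Tendsto s atTop (𝓝 0) := by
    rw [← NNReal.tendsto_coe]
    exact squeeze_zero (fun n => (s n).coe_nonneg) hs tendsto_one_div_add_atTop_nhds_zero_nat
  -- Orbits converge along `s n → 0`, so they are bounded, and uniform boundedness contradicts `‖T
  -- (s n)‖ > n`.
  obtain ⟨C, hC⟩ := banach_steinhaus (g := fun n => T (s n)) fun x => by
    obtain ⟨C, hC⟩ := (Metric.isBounded_range_of_tendsto _
      ((hT.tendsto_zero x).comp hs0)).exists_norm_le
    exact ⟨C, fun n => hC _ ⟨n, rfl⟩⟩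
  obtain ⟨n, hn⟩ := exists_nat_gt C
  exact absurd (hC n) (not_le.2 (hn.trans (hns n)))

variable {T : ℝ≥0 → X →L[ℝ] X} {D M : ℝ}

theorem IsC0Semigroup.norm_sub_le (hT : IsC0Semigroup T) (hb : ∀ s : ℝ≥0, s ≤ D → ‖T s‖ ≤ M)
    {a b : ℝ≥0} (ha : a ≤ D) (hb' : b ≤ D) (x : X) :
    ‖T a x - T b x‖ ≤ M * ‖T (nndist a b) x - x‖ := by
  wlog hab : a ≤ b generalizing a b
  · rw [norm_sub_rev, nndist_comm]
    exact this hb' ha (le_of_not_ge hab)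
  have h1 : b = a + nndist a b := by
    rw [nndist_comm, ← NNReal.coe_inj, NNReal.coe_add, coe_nndist, NNReal.dist_eq,
      abs_of_nonneg (sub_nonneg.2 (NNReal.coe_le_coe.2 hab))]
    ring
  have h2 : T b x = T a (T (nndist a b) x) := by
    conv_lhs => rw [h1, hT.map_add]
    rfl
  rw [h2, norm_sub_rev, ← map_sub]
  exact (T a).le_of_opNorm_le (hb a ha) _

theorem IsC0Semigroup.continuousOn_orbit (hT : IsC0Semigroup T) (hD : 0 ≤ D)
    (hb : ∀ s : ℝ≥0, s ≤ D → ‖T s‖ ≤ M) (x : X) :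
    ContinuousOn (fun s : ℝ => T s.toNNReal x) (Iic D) := by
  have hcoe : ∀ s ∈ Iic D, (s.toNNReal : ℝ) ≤ D := fun s hs => by
    rw [Real.coe_toNNReal']
    exact max_le hs hD
  intro s hs
  rw [ContinuousWithinAt, tendsto_iff_norm_sub_tendsto_zero]
  have h1 : Tendsto (fun r : ℝ => nndist r.toNNReal s.toNNReal) (𝓝[Iic D] s) (𝓝 0) := by
    have : Continuous fun r : ℝ => nndist r.toNNReal s.toNNReal := by fun_prop
    simpa using (this.tendsto s).mono_left (nhdsWithin_le_nhds (s := Iic D))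
  have h2 := (tendsto_iff_norm_sub_tendsto_zero.1 ((hT.tendsto_zero x).comp h1)).const_mul M
  rw [mul_zero] at h2
  refine squeeze_zero' (.of_forall fun _ => norm_nonneg _) ?_ h2
  filter_upwards [self_mem_nhdsWithin] with r hr
  exact hT.norm_sub_le hb (hcoe r hr) (hcoe s hs) x

theorem IsC0Semigroup.intervalIntegrable_orbit (hT : IsC0Semigroup T)
    (hb : ∀ s : ℝ≥0, s ≤ D → ‖T s‖ ≤ M) (x : X) {t : ℝ} (ht : 0 ≤ t) (htD : t ≤ D) :
    IntervalIntegrable (fun s : ℝ => T s.toNNReal x) MeasureTheory.volume 0 t := by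
  refine ((hT.continuousOn_orbit (ht.trans htD) hb x).mono fun s hs => ?_).intervalIntegrable
  rw [uIcc_of_le ht] at hs
  exact hs.2.trans htD

/-- The time average of an orbit over `[0, t]`. -/
noncomputable def orbitAverage (T : ℝ≥0 → X →L[ℝ] X) (t : ℝ) (x : X) : X :=
  t⁻¹ • ∫ s in (0 : ℝ)..t, T s.toNNReal x

theorem norm_orbitAverage_le (hb : ∀ s : ℝ≥0, s ≤ D → ‖T s‖ ≤ M) (x : X) {t : ℝ} (ht : 0 < t)
    (htD : t ≤ D) : ‖orbitAverage T t x‖ ≤ M * ‖x‖ := by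
  have h1 : ‖∫ s in (0 : ℝ)..t, T s.toNNReal x‖ ≤ M * ‖x‖ * |t - 0| :=
    intervalIntegral.norm_integral_le_of_norm_le_const fun s hs => by
      rw [uIoc_of_le ht.le] at hs
      refine (T _).le_of_opNorm_le (hb _ ?_) x
      rw [Real.coe_toNNReal _ hs.1.le]
      exact hs.2.trans htD
  rw [orbitAverage, norm_smul, norm_inv, Real.norm_of_nonneg ht.le, inv_mul_le_iff₀ ht]
  rw [sub_zero, abs_of_pos ht] at h1
  linarith

/-- The map `Φ` allows two uses: the identity gives norm convergence of averages, and an inner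
product gives weak estimates. -/
theorem IsC0Semigroup.norm_map_orbitAverage_sub_le [CompleteSpace X] {Y : Type*}
    [NormedAddCommGroup Y] [NormedSpace ℝ Y] [CompleteSpace Y] (hT : IsC0Semigroup T)
    (hb : ∀ s : ℝ≥0, s ≤ D → ‖T s‖ ≤ M) (Φ : X →L[ℝ] Y) (x : X) {t : ℝ} (ht : 0 < t)
    (htD : t ≤ D) {ε : ℝ} (h : ∀ s : ℝ≥0, s ≤ t → ‖Φ (T s x - x)‖ ≤ ε) :
    ‖Φ (orbitAverage T t x - x)‖ ≤ ε := by
  have hi := hT.intervalIntegrable_orbit hb x ht.le htD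
  have h1 : orbitAverage T t x - x = t⁻¹ • ∫ s in (0 : ℝ)..t, (T s.toNNReal x - x) := by
    rw [intervalIntegral.integral_sub hi intervalIntegrable_const,
      intervalIntegral.integral_const, sub_zero, smul_sub, inv_smul_smul₀ ht.ne', orbitAverage]
  have h2 : ‖∫ s in (0 : ℝ)..t, Φ (T s.toNNReal x - x)‖ ≤ ε * |t - 0| :=
    intervalIntegral.norm_integral_le_of_norm_le_const fun s hs => by
      rw [uIoc_of_le ht.le] at hs
      refine h _ ?_
      rw [Real.coe_toNNReal _ hs.1.le]
      exact hs.2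
  rw [h1, map_smul, ← Φ.intervalIntegral_comp_comm (hi.sub intervalIntegrable_const), norm_smul,
    norm_inv, Real.norm_of_nonneg ht.le, inv_mul_le_iff₀ ht]
  rw [sub_zero, abs_of_pos ht] at h2
  linarith

theorem IsC0Semigroup.tendsto_orbitAverage [CompleteSpace X] (hT : IsC0Semigroup T) (hD : 0 < D)
    (hb : ∀ s : ℝ≥0, s ≤ D → ‖T s‖ ≤ M) (x : X) :
    Tendsto (fun t => orbitAverage T t x) (𝓝[>] 0) (𝓝 x) := by
  rw [Metric.tendsto_nhds]
  intro ε hε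
  obtain ⟨η, hη, h⟩ := Metric.eventually_nhds_iff.1
    (Metric.tendsto_nhds.1 (hT.tendsto_zero x) (ε / 2) (by positivity))
  filter_upwards [Ioo_mem_nhdsGT (lt_min hD hη)] with t ht
  have := hT.norm_map_orbitAverage_sub_le hb (ContinuousLinearMap.id ℝ X) x ht.1
    (ht.2.le.trans (min_le_left _ _)) (ε := ε / 2) fun s hs => by
      rw [ContinuousLinearMap.id_apply, ← dist_eq_norm]
      refine (h ?_).le
      rw [NNReal.dist_eq, NNReal.coe_zero, sub_zero, abs_of_nonneg s.coe_nonneg]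
      exact hs.trans_lt (ht.2.trans_le (min_le_right _ _))
  rw [ContinuousLinearMap.id_apply, ← dist_eq_norm] at this
  linarith

/-- Averages intertwine with intertwiners of semigroups. -/
theorem map_orbitAverage [CompleteSpace X] {Y : Type*} [NormedAddCommGroup Y] [NormedSpace ℝ Y]
    [CompleteSpace Y] (hT : IsC0Semigroup T) (hb : ∀ s : ℝ≥0, s ≤ D → ‖T s‖ ≤ M) (Φ : X →L[ℝ] Y)
    {U : ℝ≥0 → Y →L[ℝ] Y} (hU : ∀ t x, Φ (T t x) = U t (Φ x)) (x : X) {t : ℝ} (ht : 0 ≤ t)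
    (htD : t ≤ D) : Φ (orbitAverage T t x) = orbitAverage U t (Φ x) := by
  rw [orbitAverage, map_smul, ← Φ.intervalIntegral_comp_comm
    (hT.intervalIntegrable_orbit hb x ht htD)]
  simp only [hU, orbitAverage]

theorem IsC0ContractionSemigroup.continuous_orbit (hT : IsC0ContractionSemigroup T) (x : X) :
    Continuous fun s : ℝ => T s.toNNReal x := by
  refine continuous_iff_continuousAt.2 fun s => ?_
  exact (hT.continuousOn_orbit (D := max s 0 + 1) (by positivity) (fun s _ => hT.norm_le_one s)
    x).continuousAt (Iic_mem_nhds (lt_of_le_of_lt (le_max_left s 0) (lt_add_one _)))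

/-- Averages of orbits lie in the domain of the generator, which maps them to difference
quotients. -/
theorem IsC0ContractionSemigroup.orbitAverage_mem_graph [CompleteSpace X]
    (hT : IsC0ContractionSemigroup T) {Λ : X →ₗ.[ℝ] X} (hΛ : IsSemigroupGenerator T Λ) (x : X)
    {t : ℝ} (ht : 0 < t) :
    (orbitAverage T t x, t⁻¹ • (T t.toNNReal x - x)) ∈ Λ.graph := by
  rw [hΛ]
  set F : ℝ → X := fun r => ∫ s in (0 : ℝ)..r, T s.toNNReal x with hF
  have hc := hT.continuous_orbit x
  have hder : ∀ r, HasDerivAt F (T r.toNNReal x) r := fun r =>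
    intervalIntegral.integral_hasDerivAt_right (hc.intervalIntegrable _ _)
      (hc.stronglyMeasurableAtFilter _ _) hc.continuousAt
  -- `T r` shifts the integration window, so the difference quotient of the average is, up to `t⁻¹`,
  -- the slope of `F` at `t` minus that at `0`.
  have h1 := (hasDerivAt_iff_tendsto_slope_zero.1 (hder t)).sub
    (hasDerivAt_iff_tendsto_slope_zero.1 (hder 0))
  rw [Real.toNNReal_zero, hT.map_zero, ContinuousLinearMap.id_apply] at h1
  have h2 := (h1.const_smul t⁻¹).comp ((NNReal.continuous_coe.tendsto 0).inf
    (show Tendsto ((↑) : ℝ≥0 → ℝ) (𝓟 (Ioi 0)) (𝓟 {0}ᶜ) from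
      tendsto_principal_principal.2 fun r hr => (NNReal.coe_pos.2 hr).ne'))
  refine h2.congr' ?_
  filter_upwards [self_mem_nhdsWithin] with r hr
  have h3 : T r (∫ s in (0 : ℝ)..t, T s.toNNReal x) = F (t + r) - F r := by
    rw [← (T r).intervalIntegral_comp_comm (hc.intervalIntegrable _ _), hF,
      intervalIntegral.integral_interval_sub_left (hc.intervalIntegrable _ _)
        (hc.intervalIntegrable _ _)]
    have := intervalIntegral.integral_comp_add_right (fun s : ℝ => T s.toNNReal x) (a := 0)
      (b := t) (r : ℝ)
    rw [zero_add] at this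
    rw [← this]
    refine intervalIntegral.integral_congr fun s hs => ?_
    rw [uIcc_of_le ht.le] at hs
    rw [Real.toNNReal_add hs.1 r.coe_nonneg, Real.toNNReal_coe, add_comm, hT.map_add]
    rfl
  have h4 : F 0 = 0 := by simp [hF]
  simp only [Function.comp, orbitAverage, map_smul, h3, zero_add, h4]
  change t⁻¹ • ((r : ℝ)⁻¹ • (F (t + r) - F t) - (r : ℝ)⁻¹ • (F r - 0)) =
    (r : ℝ)⁻¹ • (t⁻¹ • (F (t + r) - F r) - t⁻¹ • F t)
  module

end Semigroup

/-! ### Contraction semigroups on Hilbert space -/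

section HilbertSemigroup

variable {H : Type*} [NormedAddCommGroup H] [InnerProductSpace ℝ H]
  {T : ℝ≥0 → H →L[ℝ] H}

theorem IsC0ContractionSemigroup.inner_sub_nonpos (hT : IsC0ContractionSemigroup T) (t : ℝ≥0)
    (x : H) : inner ℝ (T t x - x) x ≤ 0 := by
  rw [inner_sub_left, real_inner_self_eq_norm_sq, sub_nonpos]
  calc inner ℝ (T t x) x ≤ ‖T t x‖ * ‖x‖ := real_inner_le_norm _ _
    _ ≤ (1 * ‖x‖) * ‖x‖ := by gcongr; exact (T t).le_of_opNorm_le (hT.norm_le_one t) x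
    _ = ‖x‖ ^ 2 := by ring

/-- Generators of contraction semigroups are dissipative. -/
theorem IsC0ContractionSemigroup.inner_generator_nonpos (hT : IsC0ContractionSemigroup T)
    {Λ : H →ₗ.[ℝ] H} (hΛ : IsSemigroupGenerator T Λ) {x y : H} (hxy : (x, y) ∈ Λ.graph) :
    inner ℝ y x ≤ 0 := by
  refine le_of_tendsto (((hΛ x y).1 hxy).inner tendsto_const_nhds) ?_
  filter_upwards with t
  rw [real_inner_smul_left]
  exact mul_nonpos_of_nonneg_of_nonpos (by positivity) (hT.inner_sub_nonpos t x)

variable [CompleteSpace H]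

/-- The adjoint of a contraction semigroup on a Hilbert space is strongly continuous at zero. -/
theorem IsC0ContractionSemigroup.tendsto_adjoint (hT : IsC0ContractionSemigroup T) (g : H) :
    Tendsto (fun s => ‖ContinuousLinearMap.adjoint (T s) g - g‖) (𝓝 0) (𝓝 0) := by
  have h1 : Tendsto (fun s => 2 * ‖g‖ ^ 2 - 2 * inner ℝ g (T s g)) (𝓝 0) (𝓝 0) := by
    have := (((tendsto_const_nhds (x := g)).inner (𝕜 := ℝ)
      (hT.tendsto_zero g)).const_mul 2).const_sub (2 * ‖g‖ ^ 2)
    simpa using this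
  have h2 : Tendsto (fun s => ‖ContinuousLinearMap.adjoint (T s) g - g‖ ^ 2) (𝓝 0) (𝓝 0) := by
    refine squeeze_zero (fun _ => by positivity) (fun s => ?_) h1
    have h3 : ‖ContinuousLinearMap.adjoint (T s) g‖ ≤ ‖g‖ := by
      have := (ContinuousLinearMap.adjoint (T s)).le_of_opNorm_le
        ((LinearIsometryEquiv.norm_map _ (T s)).trans_le (hT.norm_le_one s)) g
      rwa [one_mul] at this
    have h4 : ‖ContinuousLinearMap.adjoint (T s) g‖ ^ 2 ≤ ‖g‖ ^ 2 := by gcongr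
    rw [norm_sub_sq_real, ContinuousLinearMap.adjoint_inner_left]
    linarith
  simpa using h2.sqrt

/-- Averages of orbits converge weakly to their initial points, uniformly on bounded sets. -/
theorem IsC0ContractionSemigroup.eventually_abs_inner_orbitAverage_sub_le
    (hT : IsC0ContractionSemigroup T) (g : H) {ε : ℝ} (hε : 0 < ε) :
    ∀ᶠ t in 𝓝[>] (0 : ℝ), ∀ x, |inner ℝ g (orbitAverage T t x - x)| ≤ ε * ‖x‖ := by
  obtain ⟨η, hη, h⟩ := Metric.eventually_nhds_iff.1
    ((hT.tendsto_adjoint g).eventually (eventually_lt_nhds hε))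
  filter_upwards [Ioo_mem_nhdsGT hη] with t ht x
  refine hT.norm_map_orbitAverage_sub_le (D := t) (fun s _ => hT.norm_le_one s) (innerSL ℝ g) x
    ht.1 le_rfl fun s hs => ?_
  -- Moving the semigroup onto `g` makes the estimate uniform in `x`.
  have h1 : inner ℝ g (T s x - x) = inner ℝ (ContinuousLinearMap.adjoint (T s) g - g) x := by
    rw [inner_sub_right, inner_sub_left, ContinuousLinearMap.adjoint_inner_left]
  rw [innerSL_apply_apply, h1]
  refine (norm_inner_le_norm _ _).trans ?_
  gcongr
  refine (h ?_).le
  rw [NNReal.dist_eq, NNReal.coe_zero, sub_zero, abs_of_nonneg s.coe_nonneg]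
  exact hs.trans_lt ht.2

end HilbertSemigroup

/-! ### Closability and passage to the limit -/

section DissipativeOperators

variable {V : Type*} [NormedAddCommGroup V] [NormedSpace ℝ V]

/-- Densely defined dissipative operators from a Banach space to its dual are closable. -/
theorem LinearPMap.isClosable_of_dissipative {Λ : V →ₗ.[ℝ] StrongDual ℝ V}
    (hdis : ∀ p ∈ Λ.graph, p.2 p.1 ≤ 0) (hdense : ∀ v, ∃ x : ℕ → V,
      (∀ n, ∃ φ, (x n, φ) ∈ Λ.graph) ∧ Tendsto x atTop (𝓝 v)) : Λ.IsClosable := by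
  have hcl : ∀ p ∈ Λ.graph.topologicalClosure, p.2 p.1 ≤ 0 := by
    have hclosed : _root_.IsClosed {p : V × StrongDual ℝ V | p.2 p.1 ≤ 0} :=
      isClosed_le (continuous_snd.clm_apply continuous_fst) continuous_const
    intro p hp
    rw [← SetLike.mem_coe, Submodule.topologicalClosure_coe] at hp
    exact closure_minimal (fun q hq => hdis q hq) hclosed hp
  refine ⟨Λ.graph.topologicalClosure.toLinearPMap, ?_⟩
  rw [Submodule.toLinearPMap_graph_eq]
  rintro ⟨v, f⟩ hf (rfl : v = 0)
  -- Apply dissipativity to `(0, f) + r p`, divide by `r`, and let `r → 0`.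
  have hle : ∀ p ∈ Λ.graph, f p.1 ≤ 0 := by
    intro p hp
    have h1 : ∀ r : ℝ, 0 < r → f p.1 + r * p.2 p.1 ≤ 0 := by
      intro r hr
      have h2 := hcl _ (Submodule.add_mem _ hf
        (Submodule.smul_mem _ r (Submodule.le_topologicalClosure _ hp)))
      have h3 : (f + r • p.2) (0 + r • p.1) = r * (f p.1 + r * p.2 p.1) := by
        rw [zero_add]
        exact _root_.map_smul (f + r • p.2) r p.1
      have h4 : (f + r • p.2) (0 + r • p.1) ≤ 0 := h2
      rw [h3] at h4
      exact nonpos_of_mul_nonpos_right h4 hr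
    have h3 : Tendsto (fun r : ℝ => f p.1 + r * p.2 p.1) (𝓝[>] 0) (𝓝 (f p.1 + 0 * p.2 p.1)) :=
      ((tendsto_id.mul_const _).const_add _).mono_left nhdsWithin_le_nhds
    rw [zero_mul, add_zero] at h3
    exact le_of_tendsto h3 (by filter_upwards [self_mem_nhdsWithin] with r hr using h1 r hr)
  have hle' : ∀ v, f v ≤ 0 := fun v => by
    obtain ⟨x, hx, hxv⟩ := hdense v
    refine le_of_tendsto ((f.continuous.tendsto v).comp hxv) (.of_forall fun n => ?_)
    obtain ⟨φ, hφ⟩ := hx n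
    exact hle _ hφ
  refine ContinuousLinearMap.ext fun v => le_antisymm (hle' v) ?_
  simpa using hle' (-v)

/-- The weak limit of solutions of the approximating equations `A u - Lₙ u = f` lies in the closed
operator, and `Lₙ` satisfies the upper limit condition required by pseudo-monotonicity. -/
theorem exists_mem_closure_of_approximation (hrefl : IsReflexiveBanach V)
    (Γ : Submodule ℝ (V × StrongDual ℝ V)) (L : ℕ → V →L[ℝ] StrongDual ℝ V) (J : ℕ → V → V)
    (hL : ∀ n v, L n v v ≤ 0)
    (hLΓ : ∀ p ∈ Γ, Tendsto (fun n => L n p.1) atTop (𝓝 p.2))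
    (hJ : ∀ n v, (J n v, L n v) ∈ Γ) {M : ℝ} (hM : ∀ n v, ‖J n v‖ ≤ M * ‖v‖)
    (D : Set (StrongDual ℝ V)) (hD : ∀ v, (∀ φ ∈ D, φ v = 0) → v = 0)
    (hJD : ∀ φ ∈ D, ∀ ε > 0, ∀ᶠ n in atTop, ∀ v, |φ (J n v - v)| ≤ ε * ‖v‖)
    (𝒰 : Ultrafilter ℕ) (h𝒰 : (𝒰 : Filter ℕ) ≤ atTop) {x : ℕ → V} {R C : ℝ}
    (hx : ∀ n, ‖x n‖ ≤ R) (hLx : ∀ n, ‖L n (x n)‖ ≤ C) {u : V}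
    (hu : ∀ φ : StrongDual ℝ V, Tendsto (fun n => φ (x n)) 𝒰 (𝓝 (φ u))) :
    ∃ g, (u, g) ∈ Γ.topologicalClosure ∧
      (∀ v, Tendsto (fun n => L n (x n) v) 𝒰 (𝓝 (g v))) ∧
      ∀ ε > 0, ∀ᶠ n in 𝒰, L n (x n) (x n) ≤ g u + ε := by
  obtain ⟨g, hg⟩ := exists_tendsto_apply_of_ultrafilter 𝒰 (fun n => L n (x n)) (R := C)
    (.of_forall hLx)
  have hR : 0 ≤ R := (norm_nonneg _).trans (hx 0)
  have hmem : (u, g) ∈ Γ.topologicalClosure := by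
    obtain ⟨z, hz⟩ := hrefl.exists_weak_limit 𝒰 (fun n => J n (x n)) (R := |M| * R)
      (.of_forall fun n => (hM n _).trans (mul_le_mul (le_abs_self M) (hx n) (norm_nonneg _)
        (abs_nonneg M)))
    have hzu : z = u := by
      refine sub_eq_zero.1 (hD _ fun φ hφ => ?_)
      have h1 : Tendsto (fun n => φ (J n (x n) - x n)) 𝒰 (𝓝 (φ (z - u))) := by
        simpa only [map_sub] using (hz φ).sub (hu φ)
      have h2 : Tendsto (fun n => φ (J n (x n) - x n)) 𝒰 (𝓝 0) := by
        refine Metric.tendsto_nhds.2 fun ε hε => h𝒰 ?_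
        filter_upwards [hJD φ hφ (ε / (R + 1)) (by positivity)] with n hn
        rw [dist_zero_right, Real.norm_eq_abs]
        calc |φ (J n (x n) - x n)| ≤ ε / (R + 1) * ‖x n‖ := hn _
          _ ≤ ε / (R + 1) * R := by gcongr; exact hx n
          _ < ε := by
            rw [div_mul_eq_mul_div, div_lt_iff₀ (by positivity)]
            linarith
      exact tendsto_nhds_unique h1 h2
    rw [hzu] at hz
    refine Γ.topologicalClosure.mem_of_weak_limit (Submodule.isClosed_topologicalClosure _)
      (l := 𝒰) (x := fun n => (J n (x n), L n (x n)))
      (fun n => Submodule.le_topologicalClosure _ (hJ n (x n))) fun Ψ => ?_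
    -- By reflexivity the `V*` component of `Ψ` is evaluation at some `w`, so weak-* convergence in
    -- `V*` suffices.
    obtain ⟨w, hw⟩ := hrefl (Ψ.comp (ContinuousLinearMap.inr ℝ V (StrongDual ℝ V)))
    have hΨ : ∀ v φ, Ψ (v, φ) = Ψ.comp (ContinuousLinearMap.inl ℝ V (StrongDual ℝ V)) v + φ w := by
      intro v φ
      have h1 : φ w = Ψ.comp (ContinuousLinearMap.inr ℝ V (StrongDual ℝ V)) φ := by
        rw [← hw, NormedSpace.dual_def]
      rw [h1, ContinuousLinearMap.comp_apply, ContinuousLinearMap.comp_apply, ← map_add]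
      simp
    simp only [hΨ]
    exact (hz _).add (hg w)
  refine ⟨g, hmem, hg, fun ε hε => ?_⟩
  -- Dissipativity at `x n - w` gives `L n (x n) (x n) ≤ L n (x n) w + L n w (x n - w)`. Here `L n w
  -- → ψ` in norm, so the right side tends to the quantity bounded here.
  obtain ⟨⟨w, ψ⟩, hwΓ, hwε⟩ : ∃ p ∈ Γ, g p.1 + p.2 (u - p.1) < g u + ε / 3 := by
    have hc : Continuous fun p : V × StrongDual ℝ V => g p.1 + p.2 (u - p.1) :=
      (g.continuous.comp continuous_fst).add
        (continuous_snd.clm_apply (continuous_const.sub continuous_fst))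
    have ho : {p : V × StrongDual ℝ V | g p.1 + p.2 (u - p.1) < g u + ε / 3} ∈ 𝓝 (u, g) :=
      (isOpen_lt hc continuous_const).mem_nhds (by simpa using by positivity)
    rw [← SetLike.mem_coe, Submodule.topologicalClosure_coe] at hmem
    obtain ⟨p, hp, hpΓ⟩ := mem_closure_iff_nhds.1 hmem _ ho
    exact ⟨p, hpΓ, hp⟩
  have h1 : Tendsto (fun n => (L n w - ψ) (x n - w)) 𝒰 (𝓝 0) := by
    refine squeeze_zero_norm (a := fun n => ‖L n w - ψ‖ * (R + ‖w‖)) (fun n => ?_) ?_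
    · exact (L n w - ψ).le_opNorm_of_le ((norm_sub_le _ _).trans (add_le_add_left (hx n) _))
    · simpa using ((tendsto_iff_norm_sub_tendsto_zero.1 (hLΓ _ hwΓ)).mono_left h𝒰).mul_const
        (R + ‖w‖)
  have h2 : Tendsto (fun n => L n (x n) w + ψ (x n - w) + (L n w - ψ) (x n - w)) 𝒰
      (𝓝 (g w + ψ (u - w) + 0)) := by
    refine ((hg w).add ?_).add h1
    simpa only [map_sub] using (hu ψ).sub_const (ψ w)
  filter_upwards [h2.eventually (eventually_lt_nhds (b := g u + ε) (by
    simp only at hwε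
    linarith))] with n hn
  have h3 := hL n (x n - w)
  rw [show L n (x n - w) = L n (x n) - L n w from map_sub (L n) _ _, sub_apply, map_sub] at h3
  rw [sub_apply] at hn
  linarith

/-- Solvability of `A u - Λ u = f` for a closed operator `Λ` approximated by bounded dissipative
operators `Lₙ = Λ Jₙ`. -/
theorem IsEventuallyPseudoMonotone.exists_sub_eq_of_approximation (hrefl : IsReflexiveBanach V)
    {A : V → StrongDual ℝ V} (hA : IsEventuallyPseudoMonotone A) (hcoer : IsCoerciveOperator A)
    (hbdd : IsBoundedOnBoundedSets A)
    (Γ : Submodule ℝ (V × StrongDual ℝ V)) (L : ℕ → V →L[ℝ] StrongDual ℝ V) (J : ℕ → V → V)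
    (hL : ∀ n v, L n v v ≤ 0)
    (hLΓ : ∀ p ∈ Γ, Tendsto (fun n => L n p.1) atTop (𝓝 p.2))
    (hJ : ∀ n v, (J n v, L n v) ∈ Γ) {M : ℝ} (hM : ∀ n v, ‖J n v‖ ≤ M * ‖v‖)
    (D : Set (StrongDual ℝ V)) (hD : ∀ v, (∀ φ ∈ D, φ v = 0) → v = 0)
    (hJD : ∀ φ ∈ D, ∀ ε > 0, ∀ᶠ n in atTop, ∀ v, |φ (J n v - v)| ≤ ε * ‖v‖)
    (f : StrongDual ℝ V) : ∃ u g, (u, g) ∈ Γ.topologicalClosure ∧ A u - g = f := by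
  obtain ⟨R, hR⟩ : ∃ R : ℝ, ∀ v, R ≤ ‖v‖ → f v < A v v := by
    have h1 := (hcoer.eventually (eventually_gt_atTop ‖f‖))
    rw [← comap_norm_atTop, eventually_comap] at h1
    obtain ⟨R, hR⟩ := eventually_atTop.1 h1
    -- The `1` keeps `‖v‖` positive for the division.
    refine ⟨max R 1, fun v hv => ?_⟩
    have h2 : 0 < ‖v‖ := lt_of_lt_of_le one_pos ((le_max_right _ _).trans hv)
    have h3 := hR ‖v‖ ((le_max_left _ _).trans hv) v rfl
    rw [lt_div_iff₀ h2] at h3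
    exact (le_abs_self _).trans_lt ((f.le_opNorm v).trans_lt h3)
  have hpos : ∀ n v, R ≤ ‖v‖ → f v < (A v + (-L n) v) v := fun n v hv => by
    have h1 := hL n v
    have h2 := hR v hv
    rw [neg_apply, add_apply, neg_apply]
    linarith
  choose y hy using fun n => (hA.add_linear (-L n) fun v => by
    rw [neg_apply, neg_apply, Left.nonneg_neg_iff]; exact hL n v).exists_eq hrefl
      (hbdd.add_linear (-L n)) (hpos n)
  have hyR : ∀ n, ‖y n‖ ≤ R := fun n => by
    by_contra! hlt
    refine (hpos n _ hlt.le).ne ?_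
    rw [hy]
  have hyL : ∀ n, L n (y n) = A (y n) - f := fun n => by rw [← hy n]; simp
  obtain ⟨C, hC⟩ := hbdd.exists_norm_le (Metric.isBounded_closedBall (x := (0 : V)) (r := R))
  have hLy : ∀ n, ‖L n (y n)‖ ≤ C + ‖f‖ := fun n => by
    rw [hyL]
    exact (norm_sub_le _ _).trans (add_le_add_left (hC _ (by simpa using hyR n)) _)
  obtain ⟨u, θ, hθ, hu⟩ := hrefl.exists_weak_subseq hyR
  have key : ∀ 𝒰 : Ultrafilter ℕ, (𝒰 : Filter ℕ) ≤ atTop → ∃ g, (u, g) ∈ Γ.topologicalClosure ∧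
      (∀ v, Tendsto (fun n => L (θ n) (y (θ n)) v) 𝒰 (𝓝 (g v))) ∧
      ∀ ε > 0, ∀ᶠ n in 𝒰, L (θ n) (y (θ n)) (y (θ n)) ≤ g u + ε := fun 𝒰 h𝒰 =>
    exists_mem_closure_of_approximation hrefl Γ (fun n => L (θ n)) (fun n => J (θ n))
      (fun n => hL _) (fun p hp => (hLΓ p hp).comp hθ.tendsto_atTop) (fun n => hJ _)
      (fun n => hM _) D hD
      (fun φ hφ ε hε => hθ.tendsto_atTop.eventually (hJD φ hφ ε hε)) 𝒰 h𝒰 (fun n => hyR _)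
      (fun n => hLy _) fun φ => (hu φ).mono_left h𝒰
  have hAy : ∀ n v, A (y n) v = f v + L n (y n) v := fun n v => by rw [hyL]; simp
  have hlim : ∀ ε > 0, ∀ᶠ n in atTop, A (y (θ n)) (y (θ n) - u) ≤ ε := by
    intro ε hε
    -- The limit `g` may depend on the ultrafilter, but the upper bound does not: `g u` cancels.
    refine mem_iff_ultrafilter.2 fun 𝒰 h𝒰 => ?_
    obtain ⟨g, -, hg, hgu⟩ := key 𝒰 h𝒰
    have hε3 : 0 < ε / 3 := by positivity
    filter_upwards [hgu _ hε3, (hg u).eventually (eventually_gt_nhds (sub_lt_self _ hε3)),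
      ((hu f).mono_left h𝒰).eventually (eventually_lt_nhds (lt_add_of_pos_right _ hε3))]
      with n h1 h2 h3
    rw [hAy, map_sub, map_sub]
    linarith
  have hpm := hA (fun n => y (θ n)) u hu hlim
  obtain ⟨g, hmem, hg, hgu⟩ := key (hyperfilter ℕ) Nat.hyperfilter_le_atTop
  have hle : ∀ w, A u w ≤ f w + g w := by
    intro w
    refine le_of_forall_pos_le_add fun ε hε => ?_
    have hε4 : 0 < ε / 4 := by positivity
    obtain ⟨n, h1, h2, h3, h4⟩ := (((hpm (u - w) _ hε4).filter_mono
      Nat.hyperfilter_le_atTop).and ((hgu _ hε4).and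
        (((hg (u - w)).eventually (eventually_gt_nhds (sub_lt_self _ hε4))).and
          (((hu f).mono_left Nat.hyperfilter_le_atTop).eventually
            (eventually_lt_nhds (lt_add_of_pos_right _ hε4)))))).exists
    rw [sub_sub_cancel, hAy, map_sub f, map_sub (L (θ n) (y (θ n))), map_sub f] at h1
    rw [map_sub g] at h3
    linarith
  refine ⟨u, g, hmem, ContinuousLinearMap.ext fun w => le_antisymm ?_ ?_⟩
  · have := hle w
    rw [sub_apply]
    linarith
  · have := hle (-w)
    simp only [map_neg] at this
    rw [sub_apply]
    linarith

end DissipativeOperators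

/-! ### The Gelfand triple -/

section GelfandTriple

variable {V : Type*} [NormedAddCommGroup V] [NormedSpace ℝ V]
  {H : Type*} [NormedAddCommGroup H] [InnerProductSpace ℝ H]

theorem gelfandEmbedding_apply (ι : V →L[ℝ] H) (h : H) (v : V) :
    gelfandEmbedding ι h v = inner ℝ h (ι v) := rfl

/-- The embedding `H → V*` as a bounded operator. -/
noncomputable def gelfandEmbeddingL (ι : V →L[ℝ] H) : H →L[ℝ] StrongDual ℝ V :=
  (gelfandEmbedding ι).mkContinuous ‖ι‖ fun h =>
    ContinuousLinearMap.opNorm_le_bound _ (by positivity) fun v => by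
      rw [gelfandEmbedding_apply]
      calc ‖inner ℝ h (ι v)‖ ≤ ‖h‖ * ‖ι v‖ := norm_inner_le_norm _ _
        _ ≤ ‖h‖ * (‖ι‖ * ‖v‖) := by gcongr; exact ι.le_opNorm v
        _ = ‖ι‖ * ‖h‖ * ‖v‖ := by ring

theorem mem_graph_gelfandOperator_iff (ι : V →L[ℝ] H) (Λ : H →ₗ.[ℝ] H) (v : V)
    (φ : StrongDual ℝ V) :
    (v, φ) ∈ (gelfandOperator ι Λ).graph ↔
      ∃ y, (ι v, y) ∈ Λ.graph ∧ gelfandEmbedding ι y = φ := by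
  constructor
  · intro h
    obtain ⟨⟨w, hw⟩, rfl, h2⟩ := (LinearPMap.mem_graph_iff _).1 h
    exact ⟨Λ ⟨ι w, hw⟩, Λ.mem_graph ⟨ι w, hw⟩, h2⟩
  · rintro ⟨y, hy, rfl⟩
    obtain ⟨⟨w, hw⟩, h1, rfl⟩ := (LinearPMap.mem_graph_iff _).1 hy
    obtain rfl : w = ι v := h1
    exact (gelfandOperator ι Λ).mem_graph ⟨v, hw⟩

/-- The difference quotient of a semigroup on `H`, as an operator from `V` to `V*`. -/
noncomputable def gelfandDifferenceQuotient (ι : V →L[ℝ] H) (T : ℝ≥0 → H →L[ℝ] H) (t : ℝ) :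
    V →L[ℝ] StrongDual ℝ V :=
  (gelfandEmbeddingL ι).comp ((t⁻¹ • (T t.toNNReal - ContinuousLinearMap.id ℝ H)).comp ι)

theorem gelfandDifferenceQuotient_apply (ι : V →L[ℝ] H) (T : ℝ≥0 → H →L[ℝ] H) (t : ℝ) (v : V) :
    gelfandDifferenceQuotient ι T t v =
      gelfandEmbedding ι (t⁻¹ • (T t.toNNReal (ι v) - ι v)) := rfl

end GelfandTriple

theorem theorem2p3
    {𝓗 : Type*} [NormedAddCommGroup 𝓗] [InnerProductSpace ℝ 𝓗] [CompleteSpace 𝓗]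
    {𝓥 : Type*} [NormedAddCommGroup 𝓥] [NormedSpace ℝ 𝓥] [CompleteSpace 𝓥]
    (hrefl : IsReflexiveBanach 𝓥)
    -- the continuous dense embedding of `𝓥` into `𝓗`
    (ι : 𝓥 →L[ℝ] 𝓗) (hι : Function.Injective ι) (hdense : DenseRange ι)
    -- a `C₀`-contraction semigroup on `𝓗` with generator `Λ`
    (T : ℝ≥0 → 𝓗 →L[ℝ] 𝓗) (hT : IsC0ContractionSemigroup T)
    (Λ : 𝓗 →ₗ.[ℝ] 𝓗) (hΛ : IsSemigroupGenerator T Λ)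
    -- its restriction to `𝓥`, a `C₀`-semigroup on `𝓥`
    (S : ℝ≥0 → 𝓥 →L[ℝ] 𝓥) (hS : IsC0Semigroup S) (hST : ∀ t v, ι (S t v) = T t (ι v))
    (A : 𝓥 → StrongDual ℝ 𝓥)
    (hA : (IsMonotoneOperator A ∧ IsHemicontinuousOperator A) ∨ IsPseudoMonotoneOperator A)
    (hcoer : IsCoerciveOperator A) (hbdd : IsBoundedOnBoundedSets A) :
    (gelfandOperator ι Λ).IsClosable ∧
      ∀ f : StrongDual ℝ 𝓥, ∃ u : (gelfandOperator ι Λ).closure.domain,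
        A u - (gelfandOperator ι Λ).closure u = f := by
  obtain ⟨δ, hδ, M, hM⟩ := hS.exists_norm_le
  have hmem : ∀ t ∈ Ioc 0 δ, ∀ v,
      (orbitAverage S t v, gelfandDifferenceQuotient ι T t v) ∈ (gelfandOperator ι Λ).graph := by
    intro t ht v
    rw [mem_graph_gelfandOperator_iff, map_orbitAverage hS hM ι hST v ht.1.le ht.2]
    exact ⟨_, hT.orbitAverage_mem_graph hΛ (ι v) ht.1, rfl⟩
  let τ : ℕ → ℝ := fun n => δ / (n + 1)
  have hτ : ∀ n, τ n ∈ Ioc 0 δ := fun n =>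
    ⟨by positivity, div_le_self hδ.le (by linarith [(Nat.cast_nonneg n : (0 : ℝ) ≤ n)])⟩
  have hτ0 : Tendsto τ atTop (𝓝[>] 0) := by
    refine tendsto_nhdsWithin_iff.2 ⟨?_, .of_forall fun n => (hτ n).1⟩
    have := (tendsto_one_div_add_atTop_nhds_zero_nat (𝕜 := ℝ)).const_mul δ
    simpa only [τ, mul_one_div, mul_zero] using this
  have hclos : (gelfandOperator ι Λ).IsClosable := by
    refine LinearPMap.isClosable_of_dissipative ?_ fun v => ⟨fun n => orbitAverage S (τ n) v,
      fun n => ⟨_, hmem _ (hτ n) v⟩, (hS.tendsto_orbitAverage hδ hM v).comp hτ0⟩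
    rintro ⟨v, φ⟩ hp
    obtain ⟨y, hy, rfl⟩ := (mem_graph_gelfandOperator_iff ι Λ v φ).1 hp
    exact hT.inner_generator_nonpos hΛ hy
  refine ⟨hclos, fun f => ?_⟩
  have hpm : IsEventuallyPseudoMonotone A :=
    hA.elim (fun h => h.1.isEventuallyPseudoMonotone h.2) fun h => h.isEventuallyPseudoMonotone
  obtain ⟨u, g, hug, hsol⟩ := hpm.exists_sub_eq_of_approximation hrefl hcoer hbdd
    (gelfandOperator ι Λ).graph (fun n => gelfandDifferenceQuotient ι T (τ n))
    (fun n => orbitAverage S (τ n))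
    (fun n v => by
      rw [gelfandDifferenceQuotient_apply, gelfandEmbedding_apply, real_inner_smul_left]
      exact mul_nonpos_of_nonneg_of_nonpos (inv_nonneg.2 (hτ n).1.le) (hT.inner_sub_nonpos _ _))
    (fun p hp => by
      obtain ⟨y, hy, h2⟩ := (mem_graph_gelfandOperator_iff ι Λ p.1 p.2).1 hp
      rw [← h2]
      have h3 : Tendsto (fun n => (τ n).toNNReal) atTop (𝓝[>] 0) := by
        refine tendsto_nhdsWithin_iff.2 ⟨?_, .of_forall fun n => Real.toNNReal_pos.2 (hτ n).1⟩
        have h4 := (continuous_real_toNNReal.tendsto 0).comp (tendsto_nhdsWithin_iff.1 hτ0).1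
        rwa [Real.toNNReal_zero] at h4
      have h4 := ((gelfandEmbeddingL ι).continuous.tendsto y).comp (((hΛ _ _).1 hy).comp h3)
      refine h4.congr fun n => ?_
      simp only [Function.comp, Real.coe_toNNReal _ (hτ n).1.le]
      rfl)
    (fun n v => hmem _ (hτ n) v) (fun n v => norm_orbitAverage_le hM v (hτ n).1 (hτ n).2)
    -- Functionals coming from `𝓗` separate points of `𝓥`, and on them the contraction estimates
    -- apply.
    (range (gelfandEmbedding ι))
    (fun v hv => by
      have h1 := hv _ ⟨ι v, rfl⟩
      rw [gelfandEmbedding_apply, inner_self_eq_zero] at h1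
      exact hι (h1.trans (map_zero ι).symm))
    (by
      rintro _ ⟨h, rfl⟩ ε hε
      filter_upwards [hτ0.eventually (hT.eventually_abs_inner_orbitAverage_sub_le h
        (ε := ε / (‖ι‖ + 1)) (by positivity))] with n hn v
      rw [gelfandEmbedding_apply, map_sub, map_orbitAverage hS hM ι hST v (hτ n).1.le (hτ n).2]
      calc _ ≤ ε / (‖ι‖ + 1) * ‖ι v‖ := hn _
        _ ≤ ε / (‖ι‖ + 1) * ((‖ι‖ + 1) * ‖v‖) := by
          gcongr
          exact ι.le_of_opNorm_le (by linarith) v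
        _ = ε * ‖v‖ := by field_simp) f
  rw [hclos.graph_closure_eq_closure_graph] at hug
  obtain ⟨w, h1, h2⟩ := (LinearPMap.mem_graph_iff _).1 hug
  refine ⟨w, ?_⟩
  rw [h1, h2]
  exact hsol
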